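/- Let $\xi_0,\xi_1,\xi_2,\dots$ be i.i.d. (possibly complex) random variables with $\mathbb{E}[\xi_0]=0$ and $\mathbb{E}[|\xi_0|^2]=1$, let $f_n(z)=\sum_{k=0}^n \xi_k z^k$, fix $\theta\in(0,\pi)$, put $\zeta_0=e^{i\theta}$ and $$F_n(z)=\frac{1}{\sqrt n}\, f_n\Big(\zeta_0+\zeta_0\frac{z}{n}\Big),\qquad n\ge 1 .$$ Let $\mathcal{E}$ be the space of entire functions with the topology of uniform convergence on compact subsets of $\mathbb{C}$ and its Borel $\sigma$-algebra. Let $G$ be the Gaussian analytic function with kernel $\int_0^1 e^{(z+\overline w)t}\,dt$, that is, a random element of $\mathcal{E}$ such that $(G(z))_{z\in\mathbb{C}}$ is a mean-zero complex-valued, jointly Gaussian process with $$\mathbb{E}[G(z)G(w)]=0,\qquad \mathbb{E}\big[G(z)\overline{G(w)}\big]=\int_0^1 e^{(z+\overline w)t}\,dt\qquad (z,w\in\mathbb{C}).$$ Such a random entire function $G$ exists, and $F_n\to G$ in distribution as random elements of $\mathcal{E}$ as $n\to\infty$. -/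

import Mathlib

open MeasureTheory ProbabilityTheory Filter Topology

noncomputable section

/-- The space of entire functions `ℂ → ℂ`. -/
def EntireFun : Type := {f : C(ℂ, ℂ) // Differentiable ℂ (f : ℂ → ℂ)}

namespace EntireFun

instance : FunLike EntireFun ℂ ℂ where
  coe f := (f.1 : ℂ → ℂ)
  coe_injective _ _ h := Subtype.ext (DFunLike.coe_injective h)

/-- An everywhere complex differentiable function, as an element of `EntireFun`. -/
def mk (f : ℂ → ℂ) (hf : Differentiable ℂ f) : EntireFun := ⟨⟨f, hf.continuous⟩, hf⟩

/-- The topology of uniform convergence on compact sets: the one induced by the compact-open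
topology of `C(ℂ, ℂ)`. -/
instance : TopologicalSpace EntireFun :=
  inferInstanceAs (TopologicalSpace {f : C(ℂ, ℂ) // Differentiable ℂ (f : ℂ → ℂ)})

/-- The Borel `σ`-algebra. -/
instance : MeasurableSpace EntireFun := borel EntireFun

instance : BorelSpace EntireFun := ⟨rfl⟩

end EntireFun

/-- The Kac polynomial `f_n(z) = ∑_{k=0}^n ξ_k z^k`. -/
def kacPoly {Ω : Type*} (ξ : ℕ → Ω → ℂ) (n : ℕ) (ω : Ω) (z : ℂ) : ℂ :=
  ∑ k ∈ Finset.range (n + 1), ξ k ω * z ^ k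

/-- The rescaling `z ↦ n^{-1/2} f_n(ζ₀ + ζ₀ z / n)` around the point `ζ₀ = e^{iθ}`. -/
def rescaledKac {Ω : Type*} (ξ : ℕ → Ω → ℂ) (θ : ℝ) (n : ℕ) (ω : Ω) (z : ℂ) : ℂ :=
  1 / (Real.sqrt n : ℂ) *
    kacPoly ξ n ω (Complex.exp (Complex.I * θ) + Complex.exp (Complex.I * θ) * (z / n))

lemma differentiable_rescaledKac {Ω : Type*} (ξ : ℕ → Ω → ℂ) (θ : ℝ) (n : ℕ) (ω : Ω) :
    Differentiable ℂ (rescaledKac ξ θ n ω) := by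
  unfold rescaledKac kacPoly
  fun_prop

/-- The random entire function `F_n`. -/
def rescaledKacEntire {Ω : Type*} (ξ : ℕ → Ω → ℂ) (θ : ℝ) (n : ℕ) (ω : Ω) : EntireFun :=
  EntireFun.mk (rescaledKac ξ θ n ω) (differentiable_rescaledKac ξ θ n ω)

/-- `G` is (a version of) the Gaussian analytic function `∫₀¹ e^{zt} dB_ℂ(t)`: a random entire
function whose values form a mean-zero (jointly Gaussian) complex Gaussian process with
`E[G(z) G(w)] = 0` and `E[G(z) conj G(w)] = ∫₀¹ e^{(z + conj w) t} dt`. -/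
structure IsLimitGAF {Ω : Type*} [MeasurableSpace Ω] (G : Ω → EntireFun) (P : Measure Ω) :
    Prop where
  aemeasurable : AEMeasurable G P
  isGaussianProcess : IsGaussianProcess (fun (z : ℂ) (ω : Ω) ↦ G ω z) P
  mean_zero : ∀ z : ℂ, ∫ ω, G ω z ∂P = 0
  pseudoCovariance : ∀ z w : ℂ, ∫ ω, G ω z * G ω w ∂P = 0
  covariance : ∀ z w : ℂ, ∫ ω, G ω z * (starRingEnd ℂ) (G ω w) ∂P =
    ∫ t in (0 : ℝ)..1, Complex.exp ((z + (starRingEnd ℂ) w) * t)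

end

/-! Convergence in law in the Polish space `EntireFun` follows from tightness plus identification of
every limit point. By Prokhorov each ultrafilter limit exists
(`exists_tendsto_ultrafilter_hasGAFCharFun`), and its finite-dimensional characteristic functions
pin it down (`HasGAFCharFun.unique`).

With u = e^{iθ}, a combination of values of F_n is a sum of terms n^{-1/2} u^k w_{n,k} ξ_k, where
w_{n,k} = ∑ s_z (1 + z/n)^k. In the central limit theorem `tendsto_integral_exp_weighted_sum` the
squared moduli of the weights form a Riemann sum converging to `gafForm`. The squares without
modulus give geometric sums of ratio near u² ≠ 1; these stay bounded, so dividing by n kills them.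
Hence E[ξ₀²], which is arbitrary, leaves no trace and the limit is circular: Re has variance
`gafForm`/2, whence the 4 in the exponent.

For tightness, the j-th Taylor coefficient of F_n has second moment at most 2/j!², so a union of
Chebyshev bounds puts F_n in the compact set `coeffBounded M` with probability close to 1.

The existence of G comes for free: any limit point has the right characteristic functions, and these
force Gaussianity and the covariances (`HasGAFCharFun.isLimitGAF`). -/

noncomputable section

/-! ### The space of entire functions -/

namespace EntireFun

lemma differentiable (f : EntireFun) : Differentiable ℂ f := f.2

lemma isEmbedding_toContinuousMap : IsEmbedding (fun f : EntireFun ↦ (f.1 : C(ℂ, ℂ))) :=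
  IsEmbedding.subtypeVal

lemma continuous_eval : Continuous (fun p : EntireFun × ℂ ↦ p.1 p.2) := by
  have h : Continuous (fun p : EntireFun × ℂ ↦ ((p.1.1 : C(ℂ, ℂ)), p.2)) :=
    (isEmbedding_toContinuousMap.continuous.comp continuous_fst).prodMk continuous_snd
  exact (ContinuousEval.continuous_eval (F := C(ℂ, ℂ))).comp h

lemma continuous_eval_const (z : ℂ) : Continuous (fun f : EntireFun ↦ f z) :=
  continuous_eval.comp (by fun_prop : Continuous (fun f : EntireFun ↦ (f, z)))

/-- A jointly continuous family of entire functions is a continuous family of points of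
`EntireFun`. -/
lemma continuous_mk {X : Type*} [TopologicalSpace X] {F : X → ℂ → ℂ}
    (hF : ∀ x, Differentiable ℂ (F x)) (hc : Continuous (fun p : X × ℂ ↦ F p.1 p.2)) :
    Continuous (fun x ↦ mk (F x) (hF x)) := by
  rw [isEmbedding_toContinuousMap.continuous_iff]
  exact ContinuousMap.continuous_of_continuous_uncurry _ hc

/-- Weierstrass: locally uniform limits of holomorphic functions are holomorphic. This makes
`EntireFun` Polish. -/
lemma isClosed_differentiable :
    IsClosed {f : C(ℂ, ℂ) | Differentiable ℂ (f : ℂ → ℂ)} := by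
  rw [← isSeqClosed_iff_isClosed]
  intro f g hf hfg
  rw [ContinuousMap.tendsto_iff_tendstoLocallyUniformly] at hfg
  have := (tendstoLocallyUniformlyOn_univ.2 hfg).differentiableOn
    (Eventually.of_forall fun n ↦ (hf n).differentiableOn) isOpen_univ
  exact differentiableOn_univ.1 this

instance : PolishSpace C(ℂ, ℂ) where
  toIsCompletelyMetrizableSpace :=
    inferInstance

instance : PolishSpace EntireFun :=
  isClosed_differentiable.polishSpace

end EntireFun

/-! ### Characteristic functions of random entire functions -/

/-- The linear combination `∑ z ∈ I, s z * f z` of values of `f`. -/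
def evalSum (I : Finset ℂ) (s : ℂ → ℂ) (f : ℂ → ℂ) : ℂ := ∑ z ∈ I, s z * f z

/-- The value at `(I, s)` of the quadratic form attached to the kernel
`∫₀¹ e^{(z + conj w) t} dt`. -/
def gafForm (I : Finset ℂ) (s : ℂ → ℂ) : ℝ :=
  ∫ t in (0 : ℝ)..1, ‖evalSum I s (fun z ↦ Complex.exp (z * t))‖ ^ 2

/-- `μ` is the law of a random entire function whose finite-dimensional characteristic functions
are those of the limiting Gaussian analytic function. -/
def HasGAFCharFun (μ : Measure EntireFun) : Prop :=
  ∀ (I : Finset ℂ) (s : ℂ → ℂ),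
    ∫ f : EntireFun, Complex.exp ((evalSum I s f).re * Complex.I) ∂μ =
      (Real.exp (-(gafForm I s / 4)) : ℂ)

lemma continuous_evalSum (I : Finset ℂ) (s : ℂ → ℂ) :
    Continuous (fun f : EntireFun ↦ evalSum I s f) := by
  unfold evalSum
  exact continuous_finsetSum _ fun z _ ↦
    continuous_const.mul (EntireFun.continuous_eval_const z)

/-- Every real functional on `ι → ℂ` is the real part of a complex linear combination of
coordinates. -/
lemma exists_re_sum_eq_of_pi {ι : Type*} [Fintype ι] [DecidableEq ι] (L : StrongDual ℝ (ι → ℂ)) :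
    ∃ s : ι → ℂ, ∀ y, L y = (∑ i, s i * y i).re := by
  refine ⟨fun i ↦ ⟨L (Pi.single i 1), -L (Pi.single i Complex.I)⟩, fun y ↦ ?_⟩
  have hy : y = ∑ i, ((y i).re • (Pi.single i (1 : ℂ) : ι → ℂ) + (y i).im • (Pi.single i Complex.I : ι → ℂ)) := by
    ext j
    simp [Finset.sum_apply, Finset.sum_add_distrib, Pi.single_apply, Complex.re_add_im]
  conv_lhs => rw [hy]
  simp [map_sum, Complex.mul_re, mul_comm]

/-- Cramér–Wold: the combinations `evalSum I s` exhaust the real functionals of the marginal on `I`.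
-/
lemma HasGAFCharFun.map_restrict_eq {μ ν : Measure EntireFun} [IsFiniteMeasure μ]
    [IsFiniteMeasure ν] (hμ : HasGAFCharFun μ) (hν : HasGAFCharFun ν) (I : Finset ℂ) :
    μ.map (fun f ↦ I.restrict (fun z ↦ f z)) = ν.map (fun f ↦ I.restrict (fun z ↦ f z)) := by
  have hm : Measurable (fun f : EntireFun ↦ I.restrict (fun z ↦ f z)) :=
    measurable_pi_lambda _ fun z ↦ (EntireFun.continuous_eval_const z).measurable
  refine Measure.ext_of_charFunDual (funext fun L ↦ ?_)
  classical
  obtain ⟨s, hs⟩ := exists_re_sum_eq_of_pi L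
  let s' : ℂ → ℂ := fun z ↦ if h : z ∈ I then s ⟨z, h⟩ else 0
  have key (ρ : Measure EntireFun) : charFunDual (ρ.map (fun f ↦ I.restrict (fun z ↦ f z))) L =
      ∫ f : EntireFun, Complex.exp ((evalSum I s' f).re * Complex.I) ∂ρ := by
    rw [charFunDual_apply, integral_map hm.aemeasurable (by fun_prop)]
    congr with f
    rw [hs, evalSum, ← Finset.sum_coe_sort I]
    simp [s']
  rw [key, key, hμ, hν]

/-- The finite-dimensional characteristic functions determine the law on `EntireFun`. -/
lemma HasGAFCharFun.unique {μ ν : Measure EntireFun} [IsFiniteMeasure μ]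
    [IsFiniteMeasure ν] (hμ : HasGAFCharFun μ) (hν : HasGAFCharFun ν) : μ = ν := by
  let d := TopologicalSpace.denseSeq ℂ
  let e : EntireFun → (Set.range d → ℂ) := fun f z ↦ f z
  have hc : Continuous e := continuous_pi fun z ↦ EntireFun.continuous_eval_const z
  have hinj : Function.Injective e := by
    intro f g hfg
    refine DFunLike.coe_injective (Continuous.ext_on (TopologicalSpace.denseRange_denseSeq ℂ)
      f.differentiable.continuous g.differentiable.continuous ?_)
    exact fun z hz ↦ congrFun hfg ⟨z, hz⟩
  have : Countable (Set.range d) := (Set.countable_range d).to_subtype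
  -- Lusin–Souslin; the countability of the dense set makes the target Polish.
  have he : MeasurableEmbedding e := hc.measurableEmbedding hinj
  have hmap : μ.map e = ν.map e := by
    have h1 := isProjectiveLimit_map (P := μ) (X := fun (z : Set.range d) (f : EntireFun) ↦ f z)
      hc.measurable.aemeasurable
    have h2 := isProjectiveLimit_map (P := ν) (X := fun (z : Set.range d) (f : EntireFun) ↦ f z)
      hc.measurable.aemeasurable
    refine h1.unique (P := fun I ↦ μ.map (fun f ↦ I.restrict (fun z : Set.range d ↦ f z))) ?_
    intro I
    rw [h2 I]
    classical
    let r : (↥(I.image Subtype.val) → ℂ) → (I → ℂ) :=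
      fun y z ↦ y ⟨z.1, Finset.mem_image_of_mem _ z.2⟩
    have hr : Measurable r := measurable_pi_lambda _ fun z ↦ measurable_pi_apply _
    have hm : Measurable (fun f : EntireFun ↦ (I.image Subtype.val).restrict (fun z ↦ f z)) :=
      measurable_pi_lambda _ fun z ↦ (EntireFun.continuous_eval_const z).measurable
    have := congrArg (Measure.map r) (hμ.map_restrict_eq hν (I.image Subtype.val))
    rw [Measure.map_map hr hm, Measure.map_map hr hm] at this
    exact this.symm
  rw [← he.comap_map μ, ← he.comap_map ν, hmap]

/-! ### The limiting Gaussian analytic function and its characteristic functions -/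

lemma integral_complex_eq {α : Type*} [MeasurableSpace α] {μ : Measure α} {f : α → ℂ}
    (hf : Integrable f μ) :
    ∫ x, f x ∂μ = ⟨∫ x, (f x).re ∂μ, ∫ x, (f x).im ∂μ⟩ := by
  apply Complex.ext
  · exact (integral_re hf).symm
  · exact (integral_im hf).symm

lemma gafForm_nonneg (I : Finset ℂ) (s : ℂ → ℂ) : 0 ≤ gafForm I s :=
  intervalIntegral.integral_nonneg zero_le_one fun _ _ ↦ by positivity

lemma evalSum_real_smul (I : Finset ℂ) (s : ℂ → ℂ) (t : ℝ) (f : ℂ → ℂ) :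
    evalSum I (fun z ↦ t * s z) f = t * evalSum I s f := by
  simp [evalSum, Finset.mul_sum, mul_assoc]

lemma gafForm_real_smul (I : Finset ℂ) (s : ℂ → ℂ) (t : ℝ) :
    gafForm I (fun z ↦ t * s z) = t ^ 2 * gafForm I s := by
  simp [gafForm, evalSum_real_smul, mul_pow, intervalIntegral.integral_const_mul]

/-- Adding two `Pi.single`s keeps this valid when `z = w`: the finset collapses and the coefficients
add up. -/
lemma evalSum_pair (z w a b : ℂ) (f : ℂ → ℂ) :
    evalSum {z, w} (Pi.single z a + Pi.single w b) f = a * f z + b * f w := by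
  simp [evalSum, add_mul, Finset.sum_add_distrib, Pi.single_apply]

lemma norm_add_sq_complex (a b : ℂ) :
    ‖a + b‖ ^ 2 = ‖a‖ ^ 2 + ‖b‖ ^ 2 + 2 * (a * (starRingEnd ℂ) b).re := by
  simp only [← Complex.normSq_eq_norm_sq, Complex.normSq_add]

lemma ofReal_gafForm (I : Finset ℂ) (s : ℂ → ℂ) :
    (gafForm I s : ℂ) = ∑ z ∈ I, ∑ w ∈ I, s z * (starRingEnd ℂ) (s w) *
      ∫ t in (0 : ℝ)..1, Complex.exp ((z + (starRingEnd ℂ) w) * t) := by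
  have hi (z w : ℂ) : IntervalIntegrable (fun t : ℝ ↦ s z * (starRingEnd ℂ) (s w) *
      Complex.exp ((z + (starRingEnd ℂ) w) * t)) volume 0 1 :=
    (by fun_prop : Continuous _).intervalIntegrable _ _
  have hs (z w : ℂ) : s z * (starRingEnd ℂ) (s w) *
      (∫ t in (0 : ℝ)..1, Complex.exp ((z + (starRingEnd ℂ) w) * t)) =
      ∫ t in (0 : ℝ)..1, s z * (starRingEnd ℂ) (s w) *
        Complex.exp ((z + (starRingEnd ℂ) w) * t) := by
    rw [intervalIntegral.integral_const_mul]
  have hsum (z : ℂ) := intervalIntegral.integral_finsetSum (s := I) fun w _ ↦ hi z w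
  simp_rw [hs, ← hsum]
  rw [← intervalIntegral.integral_finsetSum fun z _ ↦ (by fun_prop : Continuous fun t : ℝ ↦
      ∑ w ∈ I, s z * (starRingEnd ℂ) (s w) *
        Complex.exp ((z + (starRingEnd ℂ) w) * t)).intervalIntegrable _ _,
    gafForm, ← intervalIntegral.integral_ofReal]
  congr with t
  rw [Complex.ofReal_pow, ← Complex.mul_conj', evalSum, map_sum, Finset.sum_mul_sum]
  refine Finset.sum_congr rfl fun z _ ↦ Finset.sum_congr rfl fun w _ ↦ ?_
  rw [map_mul, ← Complex.exp_conj, add_mul, Complex.exp_add, map_mul, Complex.conj_ofReal]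
  ring

/-- The real part of S = `evalSum I s (G ω)` is Gaussian, so its mean and variance suffice. As (Re
S)² = (Re S² + |S|²)/2, the pseudo-covariance removes the first term and the covariance evaluates
the second. -/
lemma IsLimitGAF.hasGAFCharFun {Ω : Type*} [MeasurableSpace Ω] {P : Measure Ω}
    {G : Ω → EntireFun} (hG : IsLimitGAF G P) : HasGAFCharFun (P.map G) := by
  intro I s
  have hP := hG.isGaussianProcess.isProbabilityMeasure
  have hL (z : ℂ) : MemLp (fun ω ↦ G ω z) 2 P :=
    (hG.isGaussianProcess.hasGaussianLaw_eval z).memLp_two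
  have hS : MemLp (fun ω ↦ evalSum I s (G ω)) 2 P :=
    memLp_finsetSum _ fun z _ ↦ (hL z).const_mul (s z)
  let L : (I → ℂ) →L[ℝ] ℝ := Complex.reCLM ∘L
    (∑ z : I, s z • (ContinuousLinearMap.proj (R := ℂ) (φ := fun _ : I ↦ ℂ) z)).restrictScalars ℝ
  have hLe (ω : Ω) : L (I.restrict (fun z ↦ G ω z)) = (evalSum I s (G ω)).re := by
    rw [evalSum, ← Finset.sum_coe_sort I]
    simp [L]
  have hgauss : HasGaussianLaw (fun ω ↦ (evalSum I s (G ω)).re) P := by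
    simpa only [hLe] using (hG.isGaussianProcess.hasGaussianLaw I).map_fun L
  have hmean : ∫ ω, (evalSum I s (G ω)).re ∂P = 0 := by
    have h0 : ∫ ω, evalSum I s (G ω) ∂P = 0 := by
      simp only [evalSum]
      rw [integral_finsetSum _ fun z _ ↦ ((hL z).integrable one_le_two).const_mul (s z)]
      simp [integral_const_mul, hG.mean_zero]
    have := integral_complex_eq (hS.integrable one_le_two)
    rw [h0] at this
    exact (congrArg Complex.re this).symm
  have hint (z w : ℂ) : Integrable (fun ω ↦ G ω z * G ω w) P := (hL z).integrable_mul (hL w)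
  have hint' (z w : ℂ) : Integrable (fun ω ↦ G ω z * (starRingEnd ℂ) (G ω w)) P :=
    (hL z).integrable_mul (hL w).star
  have hsq : ∫ ω, evalSum I s (G ω) * evalSum I s (G ω) ∂P = 0 := by
    have h (ω : Ω) : evalSum I s (G ω) * evalSum I s (G ω) =
        ∑ z ∈ I, ∑ w ∈ I, s z * s w * (G ω z * G ω w) := by
      rw [evalSum, Finset.sum_mul_sum]
      exact Finset.sum_congr rfl fun z _ ↦ Finset.sum_congr rfl fun w _ ↦ by ring
    simp_rw [h]
    rw [integral_finsetSum _ fun z _ ↦ integrable_finsetSum _ fun w _ ↦ (hint z w).const_mul _]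
    refine Finset.sum_eq_zero fun z _ ↦ ?_
    rw [integral_finsetSum _ fun w _ ↦ (hint z w).const_mul _]
    refine Finset.sum_eq_zero fun w _ ↦ ?_
    rw [integral_const_mul, hG.pseudoCovariance, mul_zero]
  have hnsq : ∫ ω, evalSum I s (G ω) * (starRingEnd ℂ) (evalSum I s (G ω)) ∂P =
      (gafForm I s : ℂ) := by
    have h (ω : Ω) : evalSum I s (G ω) * (starRingEnd ℂ) (evalSum I s (G ω)) =
        ∑ z ∈ I, ∑ w ∈ I, s z * (starRingEnd ℂ) (s w) * (G ω z * (starRingEnd ℂ) (G ω w)) := by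
      rw [evalSum, map_sum, Finset.sum_mul_sum]
      refine Finset.sum_congr rfl fun z _ ↦ Finset.sum_congr rfl fun w _ ↦ ?_
      rw [map_mul]; ring
    simp_rw [h]
    rw [integral_finsetSum _ fun z _ ↦ integrable_finsetSum _ fun w _ ↦ (hint' z w).const_mul _,
      ofReal_gafForm]
    refine Finset.sum_congr rfl fun z _ ↦ ?_
    rw [integral_finsetSum _ fun w _ ↦ (hint' z w).const_mul _]
    refine Finset.sum_congr rfl fun w _ ↦ ?_
    rw [integral_const_mul, hG.covariance]
  have hvar : Var[fun ω ↦ (evalSum I s (G ω)).re; P] = gafForm I s / 2 := by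
    rw [variance_of_integral_eq_zero hgauss.aemeasurable hmean]
    have i1 : Integrable (fun ω ↦ evalSum I s (G ω) * evalSum I s (G ω)) P := hS.integrable_mul hS
    have i2 : Integrable (fun ω ↦ evalSum I s (G ω) * (starRingEnd ℂ) (evalSum I s (G ω))) P :=
      hS.integrable_mul hS.star
    have h1 := congrArg Complex.re (integral_complex_eq i1)
    have h2 := congrArg Complex.re (integral_complex_eq i2)
    rw [hsq] at h1
    rw [hnsq] at h2
    simp only [Complex.zero_re, Complex.ofReal_re] at h1 h2
    have h3 (ω : Ω) : (evalSum I s (G ω)).re ^ 2 =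
        ((evalSum I s (G ω) * evalSum I s (G ω)).re +
          (evalSum I s (G ω) * (starRingEnd ℂ) (evalSum I s (G ω))).re) / 2 := by
      simp [Complex.mul_re]; ring
    simp_rw [h3]
    have i1' : Integrable (fun ω ↦ (evalSum I s (G ω) * evalSum I s (G ω)).re) P := i1.re
    have i2' : Integrable (fun ω ↦
      (evalSum I s (G ω) * (starRingEnd ℂ) (evalSum I s (G ω))).re) P := i2.re
    rw [integral_div, integral_add i1' i2', ← h1, ← h2, zero_add]
  have hm : AEStronglyMeasurable
      (fun f : EntireFun ↦ Complex.exp ((evalSum I s f).re * Complex.I)) (P.map G) := by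
    have := continuous_evalSum I s
    exact (by fun_prop : Continuous _).aestronglyMeasurable
  have hc := hgauss.charFun_map_eq 1
  rw [charFun_apply, integral_map hgauss.aemeasurable (by fun_prop)] at hc
  rw [integral_map hG.aemeasurable hm]
  simp only [RCLike.inner_apply, conj_trivial, one_mul, mul_one, hmean, hvar] at hc
  rw [hc, Complex.ofReal_exp]
  congr 1
  push_cast
  ring

/-- Scaling `s` by a real `t` yields the characteristic function of the real part at `t`. -/
lemma HasGAFCharFun.map_re_evalSum {μ : Measure EntireFun} [IsProbabilityMeasure μ]
    (hμ : HasGAFCharFun μ) (I : Finset ℂ) (s : ℂ → ℂ) :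
    μ.map (fun f : EntireFun ↦ (evalSum I s f).re) =
      gaussianReal 0 (gafForm I s / 2).toNNReal := by
  have hm : Continuous (fun f : EntireFun ↦ (evalSum I s f).re) :=
    Complex.continuous_re.comp (continuous_evalSum I s)
  have := Measure.isProbabilityMeasure_map (μ := μ) hm.measurable.aemeasurable
  refine Measure.ext_of_charFun (funext fun t ↦ ?_)
  have h := hμ I (fun z ↦ t * s z)
  simp only [evalSum_real_smul, gafForm_real_smul, Complex.re_ofReal_mul] at h
  rw [charFun_apply, integral_map hm.measurable.aemeasurable (by fun_prop), charFun_gaussianReal]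
  simp only [RCLike.inner_apply, conj_trivial]
  rw [h, Complex.ofReal_exp]
  congr 1
  rw [Real.coe_toNNReal _ (by have := gafForm_nonneg I s; positivity)]
  push_cast
  ring

lemma HasGAFCharFun.isGaussianProcess {μ : Measure EntireFun} [IsProbabilityMeasure μ]
    (hμ : HasGAFCharFun μ) : IsGaussianProcess (fun (z : ℂ) (f : EntireFun) ↦ f z) μ := by
  refine ⟨fun I ↦ ⟨isGaussian_of_map_eq_gaussianReal fun L ↦ ?_⟩⟩
  have hm : Measurable (fun f : EntireFun ↦ I.restrict (fun z ↦ f z)) :=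
    measurable_pi_lambda _ fun z ↦ (EntireFun.continuous_eval_const z).measurable
  classical
  obtain ⟨s, hs⟩ := exists_re_sum_eq_of_pi L
  let s' : ℂ → ℂ := fun z ↦ if h : z ∈ I then s ⟨z, h⟩ else 0
  refine ⟨_, _, Eq.trans ?_ (hμ.map_re_evalSum I s')⟩
  rw [Measure.map_map (by fun_prop) hm]
  refine congrArg (μ.map ·) (funext fun f ↦ ?_)
  rw [Function.comp_apply, hs, evalSum, ← Finset.sum_coe_sort I]
  simp [s']

lemma HasGAFCharFun.integral_sq_re {μ : Measure EntireFun} [IsProbabilityMeasure μ]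
    (hμ : HasGAFCharFun μ) (z w a b : ℂ) :
    ∫ f : EntireFun, (a * f z + b * f w).re ^ 2 ∂μ =
      (∫ t in (0 : ℝ)..1, ‖a * Complex.exp (z * t) + b * Complex.exp (w * t)‖ ^ 2) / 2 := by
  have h := hμ.map_re_evalSum {z, w} (Pi.single z a + Pi.single w b)
  have hm : Measurable (fun f : EntireFun ↦
      (evalSum {z, w} (Pi.single z a + Pi.single w b) f).re) :=
    (Complex.continuous_re.comp (continuous_evalSum _ _)).measurable
  have h2 := integral_map (μ := μ) hm.aemeasurable (f := fun x : ℝ ↦ x ^ 2) (by fun_prop)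
  have hv := variance_of_integral_eq_zero (X := fun x : ℝ ↦ x) (μ := gaussianReal 0
    (gafForm {z, w} (Pi.single z a + Pi.single w b) / 2).toNNReal) aemeasurable_id' (by simp)
  rw [variance_fun_id_gaussianReal, Real.coe_toNNReal _ (by
    have := gafForm_nonneg {z, w} (Pi.single z a + Pi.single w b); positivity)] at hv
  rw [h, ← hv] at h2
  simpa only [evalSum_pair, gafForm] using h2.symm

/-- Polarization of `integral_sq_re`. Taking `a`, `b` in {1, -i} later selects real and imaginary
parts. -/
lemma HasGAFCharFun.integral_re_mul_re {μ : Measure EntireFun} [IsProbabilityMeasure μ]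
    (hμ : HasGAFCharFun μ) (z w a b : ℂ) :
    ∫ f : EntireFun, (a * f z).re * (b * f w).re ∂μ =
      (a * (starRingEnd ℂ) b *
        ∫ t in (0 : ℝ)..1, Complex.exp ((z + (starRingEnd ℂ) w) * t)).re / 2 := by
  have hL (z : ℂ) : MemLp (fun f : EntireFun ↦ f z) 2 μ :=
    (hμ.isGaussianProcess.hasGaussianLaw_eval z).memLp_two
  have hr (a z : ℂ) : MemLp (fun f : EntireFun ↦ (a * f z).re) 2 μ := ((hL z).const_mul a).re
  have i1 := (hr a z).integrable_sq
  have i2 := (hr b w).integrable_sq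
  have i3 : Integrable (fun f : EntireFun ↦ (a * f z + b * f w).re ^ 2) μ :=
    (((hL z).const_mul a).add ((hL w).const_mul b)).re.integrable_sq
  have h1 := hμ.integral_sq_re z w a b
  have h2 := hμ.integral_sq_re z w a 0
  have h3 := hμ.integral_sq_re z w 0 b
  simp only [zero_mul, add_zero, zero_add] at h2 h3
  have e (f : EntireFun) : (a * f z).re * (b * f w).re =
      ((a * f z + b * f w).re ^ 2 - (a * f z).re ^ 2 - (b * f w).re ^ 2) / 2 := by
    rw [Complex.add_re]; ring
  simp_rw [e]
  have i4 : Integrable (fun f : EntireFun ↦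
    (a * f z + b * f w).re ^ 2 - (a * f z).re ^ 2) μ := i3.sub i1
  rw [integral_div, integral_sub i4 i2, integral_sub i3 i1, h1, h2, h3]
  have hi (g : ℝ → ℝ) (hg : Continuous g) : IntervalIntegrable g volume 0 1 :=
    hg.intervalIntegrable _ _
  have hK : (a * (starRingEnd ℂ) b *
        ∫ t in (0 : ℝ)..1, Complex.exp ((z + (starRingEnd ℂ) w) * t)).re =
      ∫ t in (0 : ℝ)..1, (a * Complex.exp (z * t) *
        (starRingEnd ℂ) (b * Complex.exp (w * t))).re := by
    rw [← intervalIntegral.integral_const_mul]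
    have hc : Continuous (fun t : ℝ ↦ a * (starRingEnd ℂ) b *
        Complex.exp ((z + (starRingEnd ℂ) w) * t)) := by fun_prop
    have := Complex.reCLM.intervalIntegral_comp_comm (hc.intervalIntegrable (μ := volume) 0 1)
    simp only [Complex.reCLM_apply] at this
    rw [← this]
    congr with t
    rw [map_mul, ← Complex.exp_conj, add_mul, Complex.exp_add, map_mul, Complex.conj_ofReal]
    congr 1
    ring
  rw [hK]
  simp_rw [norm_add_sq_complex]
  rw [intervalIntegral.integral_add, intervalIntegral.integral_add,
    intervalIntegral.integral_const_mul]
  · ring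
  all_goals apply hi; fun_prop

lemma HasGAFCharFun.isLimitGAF {μ : Measure EntireFun} [IsProbabilityMeasure μ]
    (hμ : HasGAFCharFun μ) : IsLimitGAF (fun f : EntireFun ↦ f) μ := by
  have hL (z : ℂ) : MemLp (fun f : EntireFun ↦ f z) 2 μ :=
    (hμ.isGaussianProcess.hasGaussianLaw_eval z).memLp_two
  have hmean (a z : ℂ) : ∫ f : EntireFun, (a * f z).re ∂μ = 0 := by
    have h := hμ.map_re_evalSum {z, z} (Pi.single z a + Pi.single z 0)
    have hm : Measurable (fun f : EntireFun ↦
        (evalSum {z, z} (Pi.single z a + Pi.single z 0) f).re) :=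
      (Complex.continuous_re.comp (continuous_evalSum _ _)).measurable
    have h2 := integral_map (μ := μ) hm.aemeasurable (f := fun x : ℝ ↦ x) (by fun_prop)
    rw [h] at h2
    simp only [evalSum_pair, zero_mul, add_zero] at h2
    rw [← h2, integral_id_gaussianReal]
  have hcov (z w : ℂ) := hμ.integral_re_mul_re z w
  have him (x : ℂ) : (-Complex.I * x).re = x.im := by simp
  have ire (z : ℂ) := (hL z).re
  have iim (z : ℂ) := (hL z).im
  refine ⟨aemeasurable_id, hμ.isGaussianProcess, fun z ↦ ?_, fun z w ↦ ?_, fun z w ↦ ?_⟩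
  · rw [integral_complex_eq ((hL z).integrable one_le_two)]
    have h1 := hmean 1 z
    have h2 := hmean (-Complex.I) z
    simp only [one_mul, him] at h1 h2
    rw [h1, h2]
    rfl
  all_goals
    have h1 := hcov z w 1 1
    have h2 := hcov z w (-Complex.I) (-Complex.I)
    have h3 := hcov z w 1 (-Complex.I)
    have h4 := hcov z w (-Complex.I) 1
    simp only [one_mul, him] at h1 h2 h3 h4
    have j1 : Integrable (fun f : EntireFun ↦ (f z).re * (f w).re) μ :=
      (ire z).integrable_mul (ire w)
    have j2 : Integrable (fun f : EntireFun ↦ (f z).im * (f w).im) μ :=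
      (iim z).integrable_mul (iim w)
    have j3 : Integrable (fun f : EntireFun ↦ (f z).re * (f w).im) μ :=
      (ire z).integrable_mul (iim w)
    have j4 : Integrable (fun f : EntireFun ↦ (f z).im * (f w).re) μ :=
      (iim z).integrable_mul (ire w)
  · have i : Integrable (fun f : EntireFun ↦ f z * f w) μ := (hL z).integrable_mul (hL w)
    rw [integral_complex_eq i]
    simp only [Complex.mul_re, Complex.mul_im]
    rw [integral_sub j1 j2, integral_add j3 j4, h1, h2, h3, h4]
    apply Complex.ext <;> simp
    ring
  · have i : Integrable (fun f : EntireFun ↦ f z * (starRingEnd ℂ) (f w)) μ :=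
      (hL z).integrable_mul (hL w).star
    rw [integral_complex_eq i]
    simp only [Complex.mul_re, Complex.mul_im,
      Complex.conj_re, Complex.conj_im, mul_neg, sub_neg_eq_add]
    simp_rw [neg_add_eq_sub]
    rw [integral_add j1 j2, integral_sub j4 j3, h1, h2, h3, h4]
    apply Complex.ext <;> simp
    ring

/-! ### A central limit theorem for weighted sums of i.i.d. complex variables -/

/-- Factors in the unit disc can be exchanged one at a time. -/
lemma norm_prod_sub_prod_le_sum {ι : Type*} (s : Finset ι) {a b : ι → ℂ}
    (ha : ∀ i ∈ s, ‖a i‖ ≤ 1) (hb : ∀ i ∈ s, ‖b i‖ ≤ 1) :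
    ‖∏ i ∈ s, a i - ∏ i ∈ s, b i‖ ≤ ∑ i ∈ s, ‖a i - b i‖ := by
  classical
  induction s using Finset.induction_on with
  | empty => simp
  | insert i s hi ih =>
    rw [Finset.prod_insert hi, Finset.prod_insert hi, Finset.sum_insert hi]
    have h1 : ‖∏ j ∈ s, a j‖ ≤ 1 := by
      rw [norm_prod]
      exact Finset.prod_le_one (fun _ _ ↦ norm_nonneg _)
        fun j hj ↦ ha j (Finset.mem_insert_of_mem hj)
    have h2 := ih (fun j hj ↦ ha j (Finset.mem_insert_of_mem hj))
      fun j hj ↦ hb j (Finset.mem_insert_of_mem hj)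
    have h3 := hb i (Finset.mem_insert_self i s)
    calc ‖a i * ∏ j ∈ s, a j - b i * ∏ j ∈ s, b j‖
        = ‖(a i - b i) * ∏ j ∈ s, a j + b i * (∏ j ∈ s, a j - ∏ j ∈ s, b j)‖ := by ring_nf
      _ ≤ ‖a i - b i‖ * ‖∏ j ∈ s, a j‖ + ‖b i‖ * ‖∏ j ∈ s, a j - ∏ j ∈ s, b j‖ := by
          refine (norm_add_le _ _).trans ?_
          rw [norm_mul, norm_mul]
      _ ≤ ‖a i - b i‖ * 1 + 1 * ∑ j ∈ s, ‖a j - b j‖ := by gcongr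
      _ = _ := by ring

lemma norm_exp_I_sub_taylor_le_cube (x : ℝ) :
    ‖Complex.exp (x * Complex.I) - (1 + x * Complex.I - x ^ 2 / 2)‖ ≤ 4 * |x| ^ 3 := by
  have hx : ‖(x : ℂ) * Complex.I‖ = |x| := by simp
  rcases le_or_gt |x| 1 with h | h
  · have hb := Complex.exp_bound (x := x * Complex.I) (by rwa [hx]) (n := 3) (by norm_num)
    have he : ∑ m ∈ Finset.range 3, ((x : ℂ) * Complex.I) ^ m / (m.factorial : ℂ) =
        1 + x * Complex.I - x ^ 2 / 2 := by
      simp [Finset.sum_range_succ, mul_pow, Nat.factorial]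
      ring
    rw [he, hx] at hb
    refine hb.trans ?_
    have : (0 : ℝ) ≤ |x| ^ 3 := by positivity
    norm_num [Nat.factorial]
    linarith
  · have h1 : ‖Complex.exp (x * Complex.I)‖ = 1 := Complex.norm_exp_ofReal_mul_I x
    have h2 : ‖(x : ℂ) ^ 2 / 2‖ = |x| ^ 2 / 2 := by simp
    calc _ ≤ ‖Complex.exp (x * Complex.I)‖ + ‖1 + x * Complex.I - x ^ 2 / 2‖ := norm_sub_le _ _
      _ ≤ 1 + ((1 + |x|) + |x| ^ 2 / 2) := by
          rw [h1]
          gcongr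
          refine (norm_sub_le _ _).trans ?_
          rw [h2]
          gcongr
          refine (norm_add_le _ _).trans ?_
          rw [hx]; simp
      _ ≤ 4 * |x| ^ 3 := by nlinarith [sq_nonneg (|x| - 1), pow_pos (by linarith : 0 < |x|) 3]

/-- Complements the cubic bound: this one is integrable under a second moment, while the cubic one
gives pointwise smallness. -/
lemma norm_exp_I_sub_taylor_le_sq (x : ℝ) :
    ‖Complex.exp (x * Complex.I) - (1 + x * Complex.I - x ^ 2 / 2)‖ ≤ 4 * |x| ^ 2 := by
  have hx : ‖(x : ℂ) * Complex.I‖ = |x| := by simp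
  rcases le_or_gt |x| 1 with h | h
  · refine (norm_exp_I_sub_taylor_le_cube x).trans ?_
    have : |x| ^ 3 ≤ |x| ^ 2 := pow_le_pow_of_le_one (abs_nonneg x) h (by norm_num)
    linarith
  · have h1 : ‖Complex.exp (x * Complex.I)‖ = 1 := Complex.norm_exp_ofReal_mul_I x
    have h2 : ‖(x : ℂ) ^ 2 / 2‖ = |x| ^ 2 / 2 := by simp
    calc _ ≤ ‖Complex.exp (x * Complex.I)‖ + ‖1 + x * Complex.I - x ^ 2 / 2‖ := norm_sub_le _ _
      _ ≤ 1 + ((1 + |x|) + |x| ^ 2 / 2) := by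
          rw [h1]
          gcongr
          refine (norm_sub_le _ _).trans ?_
          rw [h2]
          gcongr
          refine (norm_add_le _ _).trans ?_
          rw [hx]; simp
      _ ≤ 4 * |x| ^ 2 := by nlinarith

section CLT

variable {Ω : Type*} [MeasurableSpace Ω] {P : Measure Ω}

lemma norm_integral_exp_I_le_one [IsProbabilityMeasure P] (X : Ω → ℝ) : ‖∫ ω, Complex.exp (X ω * Complex.I) ∂P‖ ≤ 1 := by
  refine (norm_integral_le_integral_norm _).trans ?_
  simp [Complex.norm_exp_ofReal_mul_I]

lemma sq_re_mul_le (c x : ℂ) : (c * x).re ^ 2 ≤ ‖c‖ ^ 2 * ‖x‖ ^ 2 := by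
  rw [← mul_pow, ← norm_mul]
  exact sq_le_sq' (by linarith [Complex.abs_re_le_norm (c * x), neg_abs_le (c * x).re])
    (Complex.re_le_norm _)

/-- Second order expansion at the origin of the characteristic function of a centered complex
variable. -/
lemma exists_norm_charFun_sub_exp_le [IsProbabilityMeasure P] {X : Ω → ℂ} (hX : MemLp X 2 P) (hmean : ∫ ω, X ω ∂P = 0)
    (hvar : ∫ ω, ‖X ω‖ ^ 2 ∂P = 1) {ε : ℝ} (hε : 0 < ε) :
    ∃ δ > 0, ∀ c : ℂ, ‖c‖ < δ →
      ‖∫ ω, Complex.exp ((c * X ω).re * Complex.I) ∂P -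
        Complex.exp (-(∫ ω, (c * X ω).re ^ 2 ∂P : ℝ) / 2)‖ ≤ ε * ‖c‖ ^ 2 := by
  have hcX (c : ℂ) : MemLp (fun ω ↦ (c * X ω).re) 2 P := (hX.const_mul c).re
  have hn : Integrable (fun ω ↦ ‖X ω‖ ^ 2) P := hX.integrable_norm_pow (by norm_num)
  let D : ℂ → Ω → ℂ := fun c ω ↦ Complex.exp ((c * X ω).re * Complex.I) -
    (1 + (c * X ω).re * Complex.I - ((c * X ω).re : ℂ) ^ 2 / 2)
  have hDm (c : ℂ) : AEStronglyMeasurable (D c) P := by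
    have h1 : AEStronglyMeasurable (fun ω ↦ (c * X ω).re) P := (hcX c).aestronglyMeasurable
    have h2 : Continuous (fun x : ℝ ↦ Complex.exp (x * Complex.I) -
      (1 + x * Complex.I - (x : ℂ) ^ 2 / 2)) := by fun_prop
    exact h2.comp_aestronglyMeasurable h1
  have hDsq (c : ℂ) (ω : Ω) : ‖D c ω‖ ≤ 4 * (‖c‖ ^ 2 * ‖X ω‖ ^ 2) := by
    refine (norm_exp_I_sub_taylor_le_sq _).trans ?_
    rw [sq_abs]
    gcongr
    exact sq_re_mul_le _ _
  have hDcube (c : ℂ) (ω : Ω) : ‖D c ω‖ ≤ 4 * (‖c‖ ^ 3 * ‖X ω‖ ^ 3) := by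
    refine (norm_exp_I_sub_taylor_le_cube _).trans ?_
    rw [← mul_pow, ← norm_mul]
    gcongr
    exact Complex.abs_re_le_norm _
  have hDint (c : ℂ) : Integrable (D c) P :=
    ((hn.const_mul (‖c‖ ^ 2)).const_mul 4).mono' (hDm c) (Eventually.of_forall (hDsq c))
  -- Dominated convergence: the quadratic bound dominates and the cubic one gives the pointwise
  -- limit, so no third moment is required.
  have hlim : Tendsto (fun c : ℂ ↦ ∫ ω, ‖D c ω‖ / ‖c‖ ^ 2 ∂P) (𝓝 0) (𝓝 0) := by
    have h0 : ∫ _ : Ω, (0 : ℝ) ∂P = 0 := by simp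
    rw [← h0]
    refine tendsto_integral_filter_of_dominated_convergence (fun ω ↦ 4 * ‖X ω‖ ^ 2)
      (Eventually.of_forall fun c ↦ ?_) (Eventually.of_forall fun c ↦ Eventually.of_forall
        fun ω ↦ ?_) (hn.const_mul 4) (Eventually.of_forall fun ω ↦ ?_)
    · simp_rw [div_eq_mul_inv]
      exact (hDm c).norm.mul_const _
    · rw [Real.norm_of_nonneg (by positivity)]
      refine div_le_of_le_mul₀ (by positivity) (by positivity) ((hDsq c ω).trans (le_of_eq ?_))
      ring
    · refine squeeze_zero (g := fun c : ℂ ↦ 4 * ‖X ω‖ ^ 3 * ‖c‖) (fun c ↦ by positivity)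
        (fun c ↦ ?_) ?_
      · refine div_le_of_le_mul₀ (by positivity) (by positivity)
          ((hDcube c ω).trans (le_of_eq ?_))
        ring
      · have : Continuous (fun c : ℂ ↦ 4 * ‖X ω‖ ^ 3 * ‖c‖) := by fun_prop
        simpa using this.tendsto 0
  obtain ⟨δ, hδ, hball⟩ := Metric.eventually_nhds_iff.1
    (hlim.eventually (gt_mem_nhds (half_pos hε)))
  -- The bounds 1 and `ε` give `‖c‖ ^ 2 ≤ ε`, so the error v²/4 of the exponential is at most
  -- (ε/4)‖c‖².
  refine ⟨min δ (min 1 ε), by positivity, fun c hc ↦ ?_⟩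
  rw [lt_min_iff, lt_min_iff] at hc
  obtain ⟨hc1, hc2, hc3⟩ := hc
  set v : ℝ := ∫ ω, (c * X ω).re ^ 2 ∂P with hv
  have hsq : Integrable (fun ω ↦ (c * X ω).re ^ 2) P := (hcX c).integrable_sq
  have hv0 : 0 ≤ v := integral_nonneg fun ω ↦ sq_nonneg _
  have hv1 : v ≤ ‖c‖ ^ 2 := by
    calc v ≤ ∫ ω, ‖c‖ ^ 2 * ‖X ω‖ ^ 2 ∂P :=
          integral_mono hsq (hn.const_mul _) fun ω ↦ sq_re_mul_le _ _
      _ = ‖c‖ ^ 2 := by rw [integral_const_mul, hvar, mul_one]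
  have hre : ∫ ω, (c * X ω).re ∂P = 0 := by
    have h := congrArg Complex.re (integral_complex_eq ((hX.const_mul c).integrable one_le_two))
    rw [integral_const_mul, hmean, mul_zero] at h
    exact h.symm
  have hexp : ∫ ω, Complex.exp ((c * X ω).re * Complex.I) ∂P =
      ∫ ω, D c ω ∂P + (1 - (v : ℂ) / 2) := by
    have hr : Integrable (fun ω ↦ (((c * X ω).re : ℝ) : ℂ) * Complex.I) P :=
      (((hcX c).integrable one_le_two).ofReal).mul_const _
    have hq : Integrable (fun ω ↦ (((c * X ω).re : ℝ) : ℂ) ^ 2 / 2) P := by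
      have := (hsq.ofReal (𝕜 := ℂ)).div_const 2
      simpa using this
    have h2 : ∫ ω, (1 + ((c * X ω).re : ℂ) * Complex.I - ((c * X ω).re : ℂ) ^ 2 / 2) ∂P =
        1 - (v : ℂ) / 2 := by
      have hr1 : Integrable (fun ω ↦ 1 + (((c * X ω).re : ℝ) : ℂ) * Complex.I) P :=
        (integrable_const 1).add hr
      rw [integral_sub hr1 hq, integral_add (integrable_const 1) hr,
        integral_mul_const, integral_complex_ofReal, hre, integral_div]
      simp_rw [← Complex.ofReal_pow]
      rw [integral_complex_ofReal]
      simp [hv]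
    have h3 : Integrable (fun ω ↦
        (1 + ((c * X ω).re : ℂ) * Complex.I - ((c * X ω).re : ℂ) ^ 2 / 2)) P :=
      ((integrable_const 1).add hr).sub hq
    rw [← h2, ← integral_add (hDint c) h3]
    simp [D]
  have hD : ‖∫ ω, D c ω ∂P‖ ≤ ε / 2 * ‖c‖ ^ 2 := by
    rcases eq_or_ne c 0 with rfl | hc0
    · simp [D]
    have h := hball (by simpa using hc1 : dist c 0 < δ)
    rw [integral_div, div_lt_iff₀ (by positivity)] at h
    exact (norm_integral_le_integral_norm _).trans h.le
  have hE : ‖Complex.exp (-(v : ℂ) / 2) - 1 - (-(v : ℂ) / 2)‖ ≤ ε / 4 * ‖c‖ ^ 2 := by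
    have hnv : ‖-(v : ℂ) / 2‖ = v / 2 := by simp [abs_of_nonneg hv0]
    have hc4 : ‖c‖ ^ 2 ≤ 1 := by nlinarith [norm_nonneg c]
    refine (Complex.norm_exp_sub_one_sub_id_le (by rw [hnv]; linarith)).trans ?_
    rw [hnv]
    have hce : ‖c‖ ^ 2 ≤ ε := by nlinarith [norm_nonneg c]
    nlinarith [mul_le_mul hv1 (hv1.trans hce) hv0 (by positivity)]
  rw [hexp]
  calc ‖∫ ω, D c ω ∂P + (1 - v / 2) - Complex.exp (-(v : ℂ) / 2)‖
      = ‖∫ ω, D c ω ∂P - (Complex.exp (-(v : ℂ) / 2) - 1 - (-(v : ℂ) / 2))‖ := by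
        congr 1; ring
    _ ≤ ε / 2 * ‖c‖ ^ 2 + ε / 4 * ‖c‖ ^ 2 := (norm_sub_le _ _).trans (add_le_add hD hE)
    _ ≤ ε * ‖c‖ ^ 2 := by nlinarith [sq_nonneg ‖c‖, mul_nonneg hε.le (sq_nonneg ‖c‖)]

lemma integral_sq_re_mul {X : Ω → ℂ} (hX : MemLp X 2 P) (hvar : ∫ ω, ‖X ω‖ ^ 2 ∂P = 1) (c : ℂ) :
    ∫ ω, (c * X ω).re ^ 2 ∂P = (‖c‖ ^ 2 + (c ^ 2 * ∫ ω, X ω ^ 2 ∂P).re) / 2 := by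
  have hn : Integrable (fun ω ↦ ‖X ω‖ ^ 2) P := hX.integrable_norm_pow (by norm_num)
  have hs : Integrable (fun ω ↦ X ω ^ 2) P := by
    simp_rw [sq]
    exact hX.integrable_mul hX
  have hs' : Integrable (fun ω ↦ (c ^ 2 * X ω ^ 2).re) P := (hs.const_mul (c ^ 2)).re
  have e (ω : Ω) : (c * X ω).re ^ 2 = (‖c‖ ^ 2 * ‖X ω‖ ^ 2 + (c ^ 2 * X ω ^ 2).re) / 2 := by
    rw [← mul_pow, ← mul_pow, ← norm_mul, Complex.sq_norm, Complex.normSq_apply, sq (c * X ω),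
      Complex.mul_re (c * X ω)]
    ring
  simp_rw [e]
  have h2 := congrArg Complex.re (integral_complex_eq (hs.const_mul (c ^ 2)))
  rw [integral_const_mul] at h2
  rw [integral_div, integral_add (hn.const_mul _) hs', integral_const_mul, hvar, h2, mul_one]

/-- Independence turns the characteristic function of a weighted sum into a product. -/
lemma integral_exp_sum_eq_prod {ξ : ℕ → Ω → ℂ} (hindep : iIndepFun ξ P)
    (hident : ∀ k, IdentDistrib (ξ k) (ξ 0) P P) (s : Finset ℕ) (c : ℕ → ℂ) :
    ∫ ω, Complex.exp ((∑ k ∈ s, c k * ξ k ω).re * Complex.I) ∂P =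
      ∏ k ∈ s, ∫ ω, Complex.exp ((c k * ξ 0 ω).re * Complex.I) ∂P := by
  have hm (k : ℕ) : Measurable (fun x : ℂ ↦ Complex.exp ((c k * x).re * Complex.I)) := by
    fun_prop
  have h (k : ℕ) : ∫ ω, Complex.exp ((c k * ξ 0 ω).re * Complex.I) ∂P =
      ∫ ω, Complex.exp ((c k * ξ k ω).re * Complex.I) ∂P :=
    ((hident k).comp (hm k)).integral_eq.symm
  simp_rw [h]
  have hi := iIndepFun.integral_fun_prod_comp (X := fun (k : s) ↦ ξ k) (hindep.restrict s)
    (f := fun (k : s) x ↦ Complex.exp ((c k * x).re * Complex.I))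
    (fun k ↦ (hident k).aemeasurable_fst) (fun k ↦ (hm k).aestronglyMeasurable)
  rw [← Finset.prod_coe_sort s]
  refine Eq.trans ?_ hi
  congr with ω
  rw [Finset.prod_coe_sort s fun k ↦ Complex.exp ((c k * ξ k ω).re * Complex.I),
    ← Complex.exp_sum, Complex.re_sum, Complex.ofReal_sum, Finset.sum_mul]

/-- **Central limit theorem** for triangular arrays of complex weights, when the limit is
circularly symmetric. -/
theorem tendsto_integral_exp_weighted_sum [IsProbabilityMeasure P] {ξ : ℕ → Ω → ℂ} (hindep : iIndepFun ξ P)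
    (hident : ∀ k, IdentDistrib (ξ k) (ξ 0) P P) (hL : MemLp (ξ 0) 2 P)
    (hmean : ∫ ω, ξ 0 ω ∂P = 0) (hvar : ∫ ω, ‖ξ 0 ω‖ ^ 2 ∂P = 1)
    {s : ℕ → Finset ℕ} {c : ℕ → ℕ → ℂ} {q : ℝ}
    (hsmall : ∀ δ > 0, ∀ᶠ n in atTop, ∀ k ∈ s n, ‖c n k‖ < δ)
    (hq : Tendsto (fun n ↦ ∑ k ∈ s n, ‖c n k‖ ^ 2) atTop (𝓝 q))
    (hpseudo : Tendsto (fun n ↦ ∑ k ∈ s n, c n k ^ 2) atTop (𝓝 0)) :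
    Tendsto (fun n ↦ ∫ ω, Complex.exp ((∑ k ∈ s n, c n k * ξ k ω).re * Complex.I) ∂P) atTop
      (𝓝 (Real.exp (-(q / 4)) : ℂ)) := by
  simp_rw [integral_exp_sum_eq_prod hindep hident]
  set v : ℂ → ℝ := fun c ↦ ∫ ω, (c * ξ 0 ω).re ^ 2 ∂P with hv
  have hv0 (c : ℂ) : 0 ≤ v c := integral_nonneg fun ω ↦ sq_nonneg _
  -- E[ξ₀²] enters only as a constant factor of the sum of the `c n k ^ 2`, which tends to 0.
  have hsum : Tendsto (fun n ↦ ∑ k ∈ s n, v (c n k)) atTop (𝓝 (q / 2)) := by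
    have h1 (n : ℕ) : ∑ k ∈ s n, v (c n k) =
        (∑ k ∈ s n, ‖c n k‖ ^ 2 + ((∑ k ∈ s n, c n k ^ 2) * ∫ ω, ξ 0 ω ^ 2 ∂P).re) / 2 := by
      simp_rw [hv, integral_sq_re_mul hL hvar, ← Finset.sum_div, Finset.sum_add_distrib,
        Finset.sum_mul, Complex.re_sum]
    simp_rw [h1]
    have h2 := Complex.continuous_re.tendsto _ |>.comp (hpseudo.mul_const (∫ ω, ξ 0 ω ^ 2 ∂P))
    simpa using (hq.add h2).div_const 2
  have hprod : Tendsto (fun n ↦ ∏ k ∈ s n, Complex.exp (-(v (c n k) : ℂ) / 2)) atTop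
      (𝓝 (Real.exp (-(q / 4)) : ℂ)) := by
    have h1 (n : ℕ) : ∏ k ∈ s n, Complex.exp (-(v (c n k) : ℂ) / 2) =
        ((Real.exp (-((∑ k ∈ s n, v (c n k)) / 2)) : ℝ) : ℂ) := by
      rw [← Complex.exp_sum, Complex.ofReal_exp]
      congr 1
      push_cast
      rw [Finset.sum_div, ← Finset.sum_neg_distrib]
      exact Finset.sum_congr rfl fun _ _ ↦ by ring
    simp_rw [h1]
    have h2 : Continuous (fun x : ℝ ↦ ((Real.exp (-(x / 2)) : ℝ) : ℂ)) := by fun_prop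
    have h3 := (h2.tendsto (q / 2)).comp hsum
    rw [show q / 2 / 2 = q / 4 by ring] at h3
    exact h3
  have hdiff : Tendsto (fun n ↦ ∏ k ∈ s n, ∫ ω, Complex.exp ((c n k * ξ 0 ω).re * Complex.I) ∂P -
      ∏ k ∈ s n, Complex.exp (-(v (c n k) : ℂ) / 2)) atTop (𝓝 0) := by
    rw [Metric.tendsto_nhds]
    intro ε hε
    have hq0 : 0 ≤ q := ge_of_tendsto' hq fun n ↦ by positivity
    -- The squared norms eventually sum to less than `q + 1`, so `ε / (q + 2)` leaves a strict
    -- inequality.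
    obtain ⟨δ, hδ, hb⟩ := exists_norm_charFun_sub_exp_le hL hmean hvar
      (ε := ε / (q + 2)) (by positivity)
    filter_upwards [hsmall δ hδ, hq.eventually (gt_mem_nhds (lt_add_one q))] with n hn1 hn2
    rw [dist_zero_right]
    calc _ ≤ ∑ k ∈ s n, ‖∫ ω, Complex.exp ((c n k * ξ 0 ω).re * Complex.I) ∂P -
            Complex.exp (-(v (c n k) : ℂ) / 2)‖ := by
          refine norm_prod_sub_prod_le_sum _ (fun k _ ↦ norm_integral_exp_I_le_one _) fun k _ ↦ ?_
          rw [Complex.norm_exp]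
          have := hv0 (c n k)
          simp
          linarith
      _ ≤ ∑ k ∈ s n, ε / (q + 2) * ‖c n k‖ ^ 2 :=
          Finset.sum_le_sum fun k hk ↦ hb _ (hn1 k hk)
      _ = ε / (q + 2) * ∑ k ∈ s n, ‖c n k‖ ^ 2 := by rw [Finset.mul_sum]
      _ ≤ ε / (q + 2) * (q + 1) := by gcongr
      _ < ε := by
          rw [div_mul_eq_mul_div, div_lt_iff₀ (by positivity)]
          nlinarith
  simpa using hdiff.add hprod

end CLT

/-! ### Convergence of the finite-dimensional characteristic functions -/

/-- The range up to `2 * n` accommodates the exponent `n + 1` of the geometric sums. -/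
lemma norm_one_add_div_pow_le (z : ℂ) {n k : ℕ} (hk : k ≤ 2 * n) :
    ‖(1 + z / n) ^ k‖ ≤ Real.exp (2 * ‖z‖) := by
  have h1 : ‖1 + z / n‖ ≤ Real.exp (‖z‖ / n) := by
    refine (norm_add_le _ _).trans ?_
    rw [norm_one, norm_div, Complex.norm_natCast, add_comm]
    exact Real.add_one_le_exp _
  rw [norm_pow]
  refine (pow_le_pow_left₀ (norm_nonneg _) h1 k).trans ?_
  rw [← Real.exp_nat_mul, Real.exp_le_exp, mul_div_assoc', mul_comm (k : ℝ), mul_div_assoc,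
    mul_comm 2]
  gcongr
  exact div_le_of_le_mul₀ (by positivity) (by positivity) (by exact_mod_cast hk)

lemma tendsto_one_add_div_pow_ceil (z : ℂ) {t : ℝ} (ht : 0 ≤ t) :
    Tendsto (fun n : ℕ ↦ (1 + z / n) ^ ⌈t * n⌉₊) atTop (𝓝 (Complex.exp (z * t))) := by
  have h1 : Tendsto (fun n : ℕ ↦ (n : ℂ) * Complex.log (1 + z / n)) atTop (𝓝 z) := by
    refine Complex.tendsto_nat_mul_log_one_add_of_tendsto (tendsto_const_nhds.congr' ?_)
    filter_upwards [eventually_ne_atTop 0] with n hn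
    have : (n : ℂ) ≠ 0 := by exact_mod_cast hn
    field_simp
  have h2 : Tendsto (fun n : ℕ ↦ (⌈t * n⌉₊ : ℝ) / n) atTop (𝓝 t) :=
    (tendsto_nat_ceil_mul_div_atTop ht).comp tendsto_natCast_atTop_atTop
  have h3 : Tendsto (fun n : ℕ ↦ (((⌈t * n⌉₊ : ℝ) / n : ℝ) : ℂ)) atTop (𝓝 (t : ℂ)) :=
    (Complex.continuous_ofReal.tendsto t).comp h2
  have h4 : Tendsto (fun n : ℕ ↦ z / (n : ℂ)) atTop (𝓝 0) :=
    tendsto_const_div_atTop_nhds_zero_nat z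
  refine ((Complex.continuous_exp.tendsto (z * t)).comp (h1.mul h3)).congr' ?_
  filter_upwards [eventually_ne_atTop 0, h4.eventually_ne (show (0 : ℂ) ≠ -1 by simp)]
    with n hn hz
  have hn' : (n : ℂ) ≠ 0 := by exact_mod_cast hn
  have hne : 1 + z / n ≠ 0 := fun h ↦ hz (by linear_combination h)
  rw [Function.comp_apply, ← Complex.exp_log (x := (1 + z / n) ^ ⌈t * n⌉₊) (pow_ne_zero _ hne)]
  conv_rhs => rw [Complex.exp_log (pow_ne_zero _ hne)]
  conv_rhs => rw [← Complex.exp_log hne, ← Complex.exp_nat_mul]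
  congr 1
  push_cast
  field_simp

/-- A Riemann sum as the integral of a step function. -/
lemma integral_comp_ceil_mul {n : ℕ} (hn : n ≠ 0) (g : ℕ → ℝ) :
    ∫ t in (0 : ℝ)..1, g ⌈t * n⌉₊ = (∑ k ∈ Finset.range n, g (k + 1)) / n := by
  have hn' : (0 : ℝ) < n := by positivity
  have key (k : ℕ) : ∀ t ∈ Set.uIoc ((k : ℝ) / n) ((k + 1 : ℕ) / n), g ⌈t * n⌉₊ = g (k + 1) := by
    intro t ht
    rw [Set.uIoc_of_le (by gcongr; simp), Set.mem_Ioc, div_lt_iff₀ hn', le_div_iff₀ hn'] at ht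
    congr 1
    rw [Nat.ceil_eq_iff (by simp)]
    simpa using ht
  have hint (k : ℕ) : IntervalIntegrable (fun t : ℝ ↦ g ⌈t * n⌉₊) volume
      ((k : ℝ) / n) ((k + 1 : ℕ) / n) :=
    (intervalIntegrable_const (c := g (k + 1))).congr fun t ht ↦ (key k t ht).symm
  have h := intervalIntegral.sum_integral_adjacent_intervals (n := n)
    (a := fun k : ℕ ↦ (k : ℝ) / n) fun k _ ↦ hint k
  rw [Nat.cast_zero, zero_div, div_self hn'.ne'] at h
  rw [← h, Finset.sum_div]
  refine Finset.sum_congr rfl fun k _ ↦ ?_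
  rw [intervalIntegral.integral_congr_ae (g := fun _ ↦ g (k + 1))
    (Eventually.of_forall fun t ht ↦ key k t ht), intervalIntegral.integral_const]
  push_cast
  rw [smul_eq_mul]
  field_simp
  ring

/-- The weight of `ζ^k ξ k / √n` in the linear combination `evalSum I s` of values of the rescaled
polynomial. -/
def kacWeight (I : Finset ℂ) (s : ℂ → ℂ) (n k : ℕ) : ℂ := evalSum I s (fun z ↦ (1 + z / n) ^ k)

lemma norm_evalSum_le (I : Finset ℂ) (s : ℂ → ℂ) {f : ℂ → ℂ} {b : ℂ → ℝ}
    (h : ∀ z ∈ I, ‖f z‖ ≤ b z) : ‖evalSum I s f‖ ≤ ∑ z ∈ I, ‖s z‖ * b z := by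
  refine (norm_sum_le _ _).trans (Finset.sum_le_sum fun z hz ↦ ?_)
  rw [norm_mul]
  exact mul_le_mul_of_nonneg_left (h z hz) (norm_nonneg _)

lemma exists_norm_kacWeight_le (I : Finset ℂ) (s : ℂ → ℂ) :
    ∃ B : ℝ, 0 ≤ B ∧ ∀ n k : ℕ, k ≤ n → ‖kacWeight I s n k‖ ≤ B :=
  ⟨∑ z ∈ I, ‖s z‖ * Real.exp (2 * ‖z‖), by positivity, fun n k hk ↦
    norm_evalSum_le I s fun z _ ↦ norm_one_add_div_pow_le z (by omega)⟩

lemma tendsto_sum_norm_kacWeight_sq (I : Finset ℂ) (s : ℂ → ℂ) :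
    Tendsto (fun n : ℕ ↦ (∑ k ∈ Finset.range (n + 1), ‖kacWeight I s n k‖ ^ 2) / n) atTop
      (𝓝 (gafForm I s)) := by
  obtain ⟨B, hB0, hB⟩ := exists_norm_kacWeight_le I s
  have h1 : Tendsto (fun n : ℕ ↦ ∫ t in (0 : ℝ)..1, ‖kacWeight I s n ⌈t * n⌉₊‖ ^ 2) atTop
      (𝓝 (gafForm I s)) := by
    refine intervalIntegral.tendsto_integral_filter_of_dominated_convergence (fun _ ↦ B ^ 2)
      (Eventually.of_forall fun n ↦ ?_) (Eventually.of_forall fun n ↦ Eventually.of_forall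
        fun t ht ↦ ?_) intervalIntegrable_const (Eventually.of_forall fun t ht ↦ ?_)
    · have hm : Measurable (fun t : ℝ ↦ ⌈t * n⌉₊) := Nat.measurable_ceil.comp (by fun_prop)
      exact ((measurable_of_countable fun k : ℕ ↦ ‖kacWeight I s n k‖ ^ 2).comp
        hm).aestronglyMeasurable
    · rw [Set.uIoc_of_le zero_le_one] at ht
      rw [Real.norm_of_nonneg (by positivity)]
      have : ⌈t * n⌉₊ ≤ n := Nat.ceil_le.2 (by nlinarith [ht.2, (Nat.cast_nonneg n : (0 : ℝ) ≤ n)])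
      exact pow_le_pow_left₀ (norm_nonneg _) (hB n _ this) 2
    · rw [Set.uIoc_of_le zero_le_one] at ht
      refine ((tendsto_finsetSum I fun z _ ↦ ?_).norm).pow 2
      exact (tendsto_one_add_div_pow_ceil z ht.1.le).const_mul (s z)
  -- The ceiling takes only the values 1, …, n on (0, 1], so the term `k = 0` is handled apart.
  have h2 : Tendsto (fun n : ℕ ↦ ‖kacWeight I s n 0‖ ^ 2 / n) atTop (𝓝 0) := by
    refine squeeze_zero (fun n ↦ by positivity) (fun n ↦ ?_)
      (tendsto_const_div_atTop_nhds_zero_nat (B ^ 2))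
    gcongr
    exact hB n 0 (Nat.zero_le n)
  have h3 := h1.add h2
  rw [add_zero] at h3
  refine h3.congr' ?_
  filter_upwards [eventually_ne_atTop 0] with n hn
  rw [integral_comp_ceil_mul hn fun k ↦ ‖kacWeight I s n k‖ ^ 2, Finset.sum_range_succ', add_div]

/-- In the closed form (r^{n+1} - 1)/(r - 1) the numerator is bounded and the denominator tends to
`u - 1 ≠ 0`. -/
lemma tendsto_geom_sum_div (z w u : ℂ) (hu : ‖u‖ = 1) (hu1 : u ≠ 1) :
    Tendsto (fun n : ℕ ↦ (∑ k ∈ Finset.range (n + 1),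
      (u * ((1 + z / n) * (1 + w / n))) ^ k) / n) atTop (𝓝 0) := by
  have h0 (z : ℂ) : Tendsto (fun n : ℕ ↦ 1 + z / (n : ℂ)) atTop (𝓝 1) := by
    simpa using (tendsto_const_div_atTop_nhds_zero_nat z).const_add 1
  have hr : Tendsto (fun n : ℕ ↦ u * ((1 + z / (n : ℂ)) * (1 + w / n)) - 1) atTop
      (𝓝 (u - 1)) := by
    simpa using (((h0 z).mul (h0 w)).const_mul u).sub_const 1
  have hne : u - 1 ≠ 0 := sub_ne_zero.2 hu1
  have hinv := (hr.inv₀ hne).norm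
  set C : ℝ := Real.exp (2 * ‖z‖) * Real.exp (2 * ‖w‖) + 1
  have hlim := (tendsto_const_div_atTop_nhds_zero_nat C).mul hinv
  rw [zero_mul] at hlim
  refine squeeze_zero_norm' ?_ hlim
  filter_upwards [eventually_ge_atTop 1, hr.eventually_ne hne] with n hn hn1
  rw [geom_sum_eq (sub_ne_zero.1 hn1), norm_div, norm_div, norm_inv, Complex.norm_natCast,
    div_div, div_mul_eq_mul_div, ← div_eq_mul_inv, div_div]
  gcongr
  refine (norm_sub_le _ _).trans ?_
  rw [norm_one, mul_pow, mul_pow, norm_mul, norm_mul, norm_pow u, hu, one_pow, one_mul]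
  have hz := norm_one_add_div_pow_le z (n := n) (k := n + 1) (by omega)
  have hw := norm_one_add_div_pow_le w (n := n) (k := n + 1) (by omega)
  exact add_le_add (mul_le_mul hz hw (norm_nonneg _) (Real.exp_pos _).le) le_rfl

lemma tendsto_sum_kacWeight_sq (I : Finset ℂ) (s : ℂ → ℂ) (u : ℂ) (hu : ‖u‖ = 1)
    (hu1 : u ^ 2 ≠ 1) :
    Tendsto (fun n : ℕ ↦ (∑ k ∈ Finset.range (n + 1), (u ^ k * kacWeight I s n k) ^ 2) / n)
      atTop (𝓝 0) := by
  have h (n : ℕ) : (∑ k ∈ Finset.range (n + 1), (u ^ k * kacWeight I s n k) ^ 2) / (n : ℂ) =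
      ∑ z ∈ I, ∑ w ∈ I, s z * s w * ((∑ k ∈ Finset.range (n + 1),
        (u ^ 2 * ((1 + z / n) * (1 + w / n))) ^ k) / n) := by
    simp_rw [← mul_div_assoc, ← Finset.sum_div, Finset.mul_sum]
    congr 1
    rw [Finset.sum_congr rfl fun z _ ↦ Finset.sum_comm, Finset.sum_comm]
    refine Finset.sum_congr rfl fun k _ ↦ ?_
    rw [mul_pow, sq (kacWeight I s n k), kacWeight, evalSum, Finset.sum_mul_sum, Finset.mul_sum]
    refine Finset.sum_congr rfl fun z _ ↦ ?_
    rw [Finset.mul_sum]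
    refine Finset.sum_congr rfl fun w _ ↦ ?_
    rw [mul_pow, mul_pow, ← pow_mul, ← pow_mul, mul_comm k]
    ring
  simp_rw [h]
  have h2 : ‖u ^ 2‖ = 1 := by rw [norm_pow, hu, one_pow]
  simpa using tendsto_finsetSum I fun z _ ↦ tendsto_finsetSum I fun w _ ↦
    (tendsto_geom_sum_div z w (u ^ 2) h2 hu1).const_mul (s z * s w)

lemma norm_exp_I_mul_ofReal (θ : ℝ) : ‖Complex.exp (Complex.I * θ)‖ = 1 := by
  rw [mul_comm]; exact Complex.norm_exp_ofReal_mul_I θ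

/-- The only place where the range of θ matters: a square equal to 1 would force sin θ = 0. -/
lemma exp_I_mul_sq_ne_one {θ : ℝ} (hθ : θ ∈ Set.Ioo 0 Real.pi) :
    Complex.exp (Complex.I * θ) ^ 2 ≠ 1 := by
  have hs : 0 < Real.sin θ := Real.sin_pos_of_mem_Ioo hθ
  have him : (Complex.exp (Complex.I * θ)).im = Real.sin θ := by
    rw [mul_comm, Complex.exp_ofReal_mul_I_im]
  intro h
  rcases mul_self_eq_one_iff.1 (sq (Complex.exp _) ▸ h) with h | h
  all_goals
    rw [h] at him
    simp at him
    linarith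

lemma rescaledKac_eq {Ω : Type*} (ξ : ℕ → Ω → ℂ) (θ : ℝ) (n : ℕ) (ω : Ω) (z : ℂ) :
    rescaledKac ξ θ n ω z = ∑ k ∈ Finset.range (n + 1),
      1 / (Real.sqrt n : ℂ) * (Complex.exp (Complex.I * θ) ^ k * (1 + z / n) ^ k) * ξ k ω := by
  rw [rescaledKac, kacPoly, Finset.mul_sum]
  refine Finset.sum_congr rfl fun k _ ↦ ?_
  rw [← mul_pow, mul_add, mul_one]
  ring

lemma evalSum_rescaledKac {Ω : Type*} (ξ : ℕ → Ω → ℂ) (θ : ℝ) (n : ℕ) (ω : Ω) (I : Finset ℂ)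
    (s : ℂ → ℂ) :
    evalSum I s (rescaledKac ξ θ n ω) = ∑ k ∈ Finset.range (n + 1), 1 / (Real.sqrt n : ℂ) *
      (Complex.exp (Complex.I * θ) ^ k * kacWeight I s n k) * ξ k ω := by
  simp_rw [evalSum, rescaledKac_eq, kacWeight, evalSum, Finset.mul_sum, Finset.sum_mul]
  rw [Finset.sum_comm]
  exact Finset.sum_congr rfl fun k _ ↦ Finset.sum_congr rfl fun z _ ↦ by ring

theorem tendsto_integral_exp_evalSum_rescaledKac {Ω : Type*} [MeasurableSpace Ω] {P : Measure Ω}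
    [IsProbabilityMeasure P] {ξ : ℕ → Ω → ℂ} (hindep : iIndepFun ξ P)
    (hident : ∀ k, IdentDistrib (ξ k) (ξ 0) P P) (hL : MemLp (ξ 0) 2 P)
    (hmean : ∫ ω, ξ 0 ω ∂P = 0) (hvar : ∫ ω, ‖ξ 0 ω‖ ^ 2 ∂P = 1)
    {θ : ℝ} (hθ : θ ∈ Set.Ioo 0 Real.pi) (I : Finset ℂ) (s : ℂ → ℂ) :
    Tendsto (fun n ↦ ∫ ω, Complex.exp ((evalSum I s (rescaledKac ξ θ n ω)).re * Complex.I) ∂P)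
      atTop (𝓝 (Real.exp (-(gafForm I s / 4)) : ℂ)) := by
  simp_rw [evalSum_rescaledKac]
  set u := Complex.exp (Complex.I * θ) with hu
  have hu1 : ‖u‖ = 1 := norm_exp_I_mul_ofReal θ
  have hnorm (n k : ℕ) : ‖1 / (Real.sqrt n : ℂ) * (u ^ k * kacWeight I s n k)‖ =
      ‖kacWeight I s n k‖ / Real.sqrt n := by
    rw [norm_mul, norm_mul, norm_pow, hu1, one_pow, one_mul, norm_div, norm_one,
      Complex.norm_of_nonneg (Real.sqrt_nonneg _)]
    ring
  refine tendsto_integral_exp_weighted_sum hindep hident hL hmean hvar ?_ ?_ ?_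
  · intro δ hδ
    obtain ⟨B, hB0, hB⟩ := exists_norm_kacWeight_le I s
    have hlim : Tendsto (fun n : ℕ ↦ B / Real.sqrt n) atTop (𝓝 0) :=
      tendsto_const_nhds.div_atTop (Real.tendsto_sqrt_atTop.comp tendsto_natCast_atTop_atTop)
    filter_upwards [hlim.eventually (gt_mem_nhds hδ)] with n hn k hk
    rw [hnorm]
    refine lt_of_le_of_lt ?_ hn
    gcongr
    exact hB n k (Nat.lt_succ_iff.1 (Finset.mem_range.1 hk))
  · refine (tendsto_sum_norm_kacWeight_sq I s).congr fun n ↦ ?_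
    rw [Finset.sum_div]
    refine Finset.sum_congr rfl fun k _ ↦ ?_
    rw [hnorm, div_pow, Real.sq_sqrt (Nat.cast_nonneg n)]
  · refine (tendsto_sum_kacWeight_sq I s u hu1 (exp_I_mul_sq_ne_one hθ)).congr fun n ↦ ?_
    rw [Finset.sum_div]
    refine Finset.sum_congr rfl fun k _ ↦ ?_
    rw [mul_pow (1 / (Real.sqrt n : ℂ)), div_pow, one_pow, ← Complex.ofReal_pow,
      Real.sq_sqrt (Nat.cast_nonneg n)]
    push_cast
    ring

/-! ### Tightness -/

section SecondMoment

variable {Ω : Type*} [MeasurableSpace Ω] {P : Measure Ω}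

lemma integral_sq_re_weighted_sum [IsProbabilityMeasure P] {ξ : ℕ → Ω → ℂ}
    (hindep : iIndepFun ξ P) (hident : ∀ k, IdentDistrib (ξ k) (ξ 0) P P) (hL : MemLp (ξ 0) 2 P)
    (hmean : ∫ ω, ξ 0 ω ∂P = 0) (s : Finset ℕ) (c : ℕ → ℂ) :
    ∫ ω, (∑ k ∈ s, c k * ξ k ω).re ^ 2 ∂P = ∑ k ∈ s, ∫ ω, (c k * ξ 0 ω).re ^ 2 ∂P := by
  have hm (k : ℕ) : Measurable (fun x : ℂ ↦ (c k * x).re) := by fun_prop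
  have hLk (k : ℕ) : MemLp (ξ k) 2 P := (hident k).memLp_iff.2 hL
  let Y : ℕ → Ω → ℝ := fun k ω ↦ (c k * ξ k ω).re
  have hY (k : ℕ) : MemLp (Y k) 2 P := ((hLk k).const_mul (c k)).re
  have hY0 (k : ℕ) : ∫ ω, Y k ω ∂P = 0 := by
    have h := congrArg Complex.re
      (integral_complex_eq (((hLk k).const_mul (c k)).integrable one_le_two))
    rw [integral_const_mul, (hident k).integral_eq, hmean, mul_zero] at h
    exact h.symm
  have hvar := IndepFun.variance_sum (X := Y) (s := s) (fun k _ ↦ hY k)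
    fun i _ j _ hij ↦ (hindep.indepFun hij).comp (hm i) (hm j)
  have hsum0 : ∫ ω, (∑ k ∈ s, Y k) ω ∂P = 0 := by
    simp only [Finset.sum_apply]
    rw [integral_finsetSum _ fun k _ ↦ (hY k).integrable one_le_two]
    exact Finset.sum_eq_zero fun k _ ↦ hY0 k
  rw [variance_of_integral_eq_zero
    (Finset.aemeasurable_sum s fun k _ ↦ (hY k).aestronglyMeasurable.aemeasurable) hsum0] at hvar
  calc ∫ ω, (∑ k ∈ s, c k * ξ k ω).re ^ 2 ∂P = ∫ ω, (∑ k ∈ s, Y k) ω ^ 2 ∂P := by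
        simp [Y, Finset.sum_apply, Complex.re_sum]
    _ = ∑ k ∈ s, Var[Y k; P] := hvar
    _ = ∑ k ∈ s, ∫ ω, (c k * ξ 0 ω).re ^ 2 ∂P := by
        refine Finset.sum_congr rfl fun k _ ↦ ?_
        rw [variance_of_integral_eq_zero (hY k).aestronglyMeasurable.aemeasurable (hY0 k)]
        exact ((hident k).comp ((hm k).pow_const 2)).integral_eq

/-- Apply the real-part identity to `c` and `-i c`; the E[ξ₀²] terms cancel since (-i)² = -1. -/
lemma integral_norm_sq_weighted_sum [IsProbabilityMeasure P] {ξ : ℕ → Ω → ℂ}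
    (hindep : iIndepFun ξ P) (hident : ∀ k, IdentDistrib (ξ k) (ξ 0) P P) (hL : MemLp (ξ 0) 2 P)
    (hmean : ∫ ω, ξ 0 ω ∂P = 0) (hvar : ∫ ω, ‖ξ 0 ω‖ ^ 2 ∂P = 1) (s : Finset ℕ) (c : ℕ → ℂ) :
    ∫ ω, ‖∑ k ∈ s, c k * ξ k ω‖ ^ 2 ∂P = ∑ k ∈ s, ‖c k‖ ^ 2 := by
  have hLs (c : ℕ → ℂ) : MemLp (fun ω ↦ ∑ k ∈ s, c k * ξ k ω) 2 P :=
    memLp_finsetSum _ fun k _ ↦ ((hident k).memLp_iff.2 hL).const_mul (c k)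
  have hre (c : ℕ → ℂ) : MemLp (fun ω ↦ (∑ k ∈ s, c k * ξ k ω).re) 2 P := (hLs c).re
  have e (ω : Ω) : ‖∑ k ∈ s, c k * ξ k ω‖ ^ 2 = (∑ k ∈ s, c k * ξ k ω).re ^ 2 +
      (∑ k ∈ s, (-Complex.I * c k) * ξ k ω).re ^ 2 := by
    simp_rw [mul_assoc]
    rw [← Finset.mul_sum, Complex.sq_norm, Complex.normSq_apply]
    simp
    ring
  simp_rw [e]
  rw [integral_add (hre c).integrable_sq (hre fun k ↦ -Complex.I * c k).integrable_sq,
    integral_sq_re_weighted_sum hindep hident hL hmean,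
    integral_sq_re_weighted_sum hindep hident hL hmean, ← Finset.sum_add_distrib]
  refine Finset.sum_congr rfl fun k _ ↦ ?_
  rw [integral_sq_re_mul hL hvar, integral_sq_re_mul hL hvar, mul_pow, norm_mul]
  simp
  ring

end SecondMoment

/-- The Taylor coefficients at the origin of the rescaled Kac polynomial. -/
def kacCoeff {Ω : Type*} (ξ : ℕ → Ω → ℂ) (θ : ℝ) (n j : ℕ) (ω : Ω) : ℂ :=
  ∑ k ∈ Finset.range (n + 1), 1 / (Real.sqrt n : ℂ) *
    (Complex.exp (Complex.I * θ) ^ k * ((k.choose j : ℂ) / (n : ℂ) ^ j)) * ξ k ω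

lemma kacCoeff_eq_zero {Ω : Type*} (ξ : ℕ → Ω → ℂ) (θ : ℝ) {n j : ℕ} (hj : n < j) (ω : Ω) :
    kacCoeff ξ θ n j ω = 0 := by
  refine Finset.sum_eq_zero fun k hk ↦ ?_
  rw [Nat.choose_eq_zero_of_lt (by have := Finset.mem_range.1 hk; omega)]
  simp

lemma rescaledKac_eq_tsum {Ω : Type*} (ξ : ℕ → Ω → ℂ) (θ : ℝ) (n : ℕ) (ω : Ω) (z : ℂ) :
    rescaledKac ξ θ n ω z = ∑' j, kacCoeff ξ θ n j ω * z ^ j := by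
  rw [tsum_eq_sum (s := Finset.range (n + 1)) fun j hj ↦ by
    rw [kacCoeff_eq_zero ξ θ (by simpa using hj), zero_mul]]
  simp_rw [rescaledKac_eq, kacCoeff, Finset.sum_mul]
  rw [Finset.sum_comm]
  refine Finset.sum_congr rfl fun k hk ↦ ?_
  have hpow : (1 + z / n) ^ k =
      ∑ j ∈ Finset.range (n + 1), (k.choose j : ℂ) / (n : ℂ) ^ j * z ^ j := by
    rw [add_comm, add_pow]
    refine Eq.trans (Finset.sum_subset (s₂ := Finset.range (n + 1))
      (Finset.range_mono (by have := Finset.mem_range.1 hk; omega)) fun j _ hj ↦ ?_)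
      (Finset.sum_congr rfl fun j _ ↦ ?_)
    · rw [Nat.choose_eq_zero_of_lt (by simpa using hj)]
      simp
    · rw [one_pow, div_pow]
      ring
  rw [hpow, Finset.mul_sum, Finset.mul_sum, Finset.sum_mul]
  exact Finset.sum_congr rfl fun j _ ↦ by ring

/-- Since C(k, j) ≤ n^j/j!, each of the n + 1 terms is at most 1/(n j!²), and (n + 1)/n ≤ 2. -/
lemma integral_norm_sq_kacCoeff_le {Ω : Type*} [MeasurableSpace Ω] {P : Measure Ω}
    [IsProbabilityMeasure P] {ξ : ℕ → Ω → ℂ} (hindep : iIndepFun ξ P)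
    (hident : ∀ k, IdentDistrib (ξ k) (ξ 0) P P) (hL : MemLp (ξ 0) 2 P)
    (hmean : ∫ ω, ξ 0 ω ∂P = 0) (hvar : ∫ ω, ‖ξ 0 ω‖ ^ 2 ∂P = 1) (θ : ℝ) (n j : ℕ) :
    ∫ ω, ‖kacCoeff ξ θ n j ω‖ ^ 2 ∂P ≤ 2 / (j.factorial : ℝ) ^ 2 := by
  simp only [kacCoeff]
  rw [integral_norm_sq_weighted_sum hindep hident hL hmean hvar]
  rcases Nat.eq_zero_or_pos n with rfl | hn
  · simp
    positivity
  have hn' : (0 : ℝ) < n := by exact_mod_cast hn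
  have hterm (k : ℕ) (hk : k ∈ Finset.range (n + 1)) : ‖1 / (Real.sqrt n : ℂ) *
      (Complex.exp (Complex.I * θ) ^ k * ((k.choose j : ℂ) / (n : ℂ) ^ j))‖ ^ 2 ≤
      1 / n * (1 / (j.factorial : ℝ) ^ 2) := by
    have hkn : (k : ℝ) ≤ n := by exact_mod_cast Nat.lt_succ_iff.1 (Finset.mem_range.1 hk)
    rw [norm_mul, norm_mul, norm_pow, norm_exp_I_mul_ofReal, one_pow, one_mul, norm_div, norm_one,
      Complex.norm_of_nonneg (Real.sqrt_nonneg _), norm_div, norm_pow, Complex.norm_natCast,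
      Complex.norm_natCast, mul_pow, div_pow 1, one_pow, Real.sq_sqrt hn'.le]
    gcongr
    rw [← one_div_pow]
    refine pow_le_pow_left₀ (by positivity) ?_ 2
    rw [div_le_div_iff₀ (by positivity) (by positivity), one_mul]
    have h := Nat.choose_le_pow_div (α := ℝ) j k
    rw [le_div_iff₀ (by positivity)] at h
    exact h.trans (by gcongr)
  refine (Finset.sum_le_sum hterm).trans ?_
  rw [Finset.sum_const, Finset.card_range, nsmul_eq_mul, ← mul_assoc, mul_one_div, mul_one_div]
  gcongr
  rw [div_le_iff₀ hn']
  have : (1 : ℝ) ≤ n := by exact_mod_cast hn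
  push_cast
  linarith

namespace EntireFun

/-- Entire functions whose Taylor coefficients at the origin satisfy `‖a j‖ ≤ M * 2 ^ j / j!`. -/
def coeffBounded (M : ℝ) : Set EntireFun :=
  {f | ∃ a : ℕ → ℂ, (∀ j, ‖a j‖ ≤ M * (2 ^ j / j.factorial)) ∧ ∀ z, f z = ∑' j, a j * z ^ j}

/-- The set is the continuous image of a product of closed discs, compact by Tychonoff; the M-test
on balls gives the continuity. -/
lemma isCompact_coeffBounded (M : ℝ) : IsCompact (coeffBounded M) := by
  let A : Type := (j : ℕ) → Metric.closedBall (0 : ℂ) (M * (2 ^ j / j.factorial))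
  let S : A → ℂ → ℂ := fun a z ↦ ∑' j, (a j : ℂ) * z ^ j
  have hsum (R : ℝ) : Summable fun j : ℕ ↦ M * ((2 * R) ^ j / j.factorial) :=
    (Real.summable_pow_div_factorial _).mul_left M
  have hbound (R : ℝ) (a : A) (z : ℂ) (hz : z ∈ Metric.ball (0 : ℂ) R) (j : ℕ) :
      ‖(a j : ℂ) * z ^ j‖ ≤ M * ((2 * R) ^ j / j.factorial) := by
    have h1 : ‖(a j : ℂ)‖ ≤ M * (2 ^ j / j.factorial) := mem_closedBall_zero_iff.1 (a j).2
    have h2 : ‖z‖ ≤ R := (mem_ball_zero_iff.1 hz).le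
    rw [norm_mul, norm_pow]
    calc ‖(a j : ℂ)‖ * ‖z‖ ^ j ≤ M * (2 ^ j / j.factorial) * R ^ j :=
          mul_le_mul h1 (pow_le_pow_left₀ (norm_nonneg _) h2 j) (by positivity)
            ((norm_nonneg _).trans h1)
      _ = _ := by rw [mul_pow]; ring
  have hdiff (a : A) : Differentiable ℂ (S a) := by
    intro z
    have hz : z ∈ Metric.ball (0 : ℂ) (‖z‖ + 1) := by simp
    exact (Complex.differentiableOn_tsum_of_summable_norm (hsum (‖z‖ + 1))
      (fun j ↦ by fun_prop) Metric.isOpen_ball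
      fun j w hw ↦ hbound _ a w hw j).differentiableAt (Metric.isOpen_ball.mem_nhds hz)
  have hcont : Continuous (fun p : A × ℂ ↦ S p.1 p.2) := by
    rw [continuous_iff_continuousAt]
    rintro ⟨a, z⟩
    have hopen : IsOpen (Set.univ ×ˢ Metric.ball (0 : ℂ) (‖z‖ + 1) : Set (A × ℂ)) :=
      isOpen_univ.prod Metric.isOpen_ball
    refine (continuousOn_tsum (fun j ↦ Continuous.continuousOn ?_) (hsum (‖z‖ + 1))
      fun j p hp ↦ hbound _ p.1 p.2 hp.2 j).continuousAt (hopen.mem_nhds ⟨trivial, by simp⟩)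
    exact ((continuous_subtype_val.comp ((continuous_apply j).comp continuous_fst))).mul
      (continuous_snd.pow j)
  have (j : ℕ) : CompactSpace (Metric.closedBall (0 : ℂ) (M * (2 ^ j / j.factorial))) :=
    isCompact_iff_compactSpace.1 (isCompact_closedBall _ _)
  have hA : CompactSpace A := inferInstanceAs
    (CompactSpace ((j : ℕ) → Metric.closedBall (0 : ℂ) (M * (2 ^ j / j.factorial))))
  convert isCompact_range (continuous_mk hdiff hcont)
  ext f
  refine ⟨fun ⟨a, ha, hf⟩ ↦ ⟨fun j ↦ ⟨a j, mem_closedBall_zero_iff.2 (ha j)⟩, ?_⟩, ?_⟩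
  · exact DFunLike.coe_injective (funext fun z ↦ (hf z).symm)
  · rintro ⟨a, rfl⟩
    exact ⟨fun j ↦ a j, fun j ↦ mem_closedBall_zero_iff.1 (a j).2, fun z ↦ rfl⟩

end EntireFun

section Tightness

variable {Ω : Type*} [MeasurableSpace Ω] {P : Measure Ω} {ξ : ℕ → Ω → ℂ}

/-- F_n is a continuous function of the coefficient sequence. -/
lemma aemeasurable_rescaledKacEntire (hξ : ∀ k, AEMeasurable (ξ k) P) (θ : ℝ) (n : ℕ) :
    AEMeasurable (rescaledKacEntire ξ θ n) P := by
  have hc : Continuous (rescaledKacEntire (fun k (x : ℕ → ℂ) ↦ x k) θ n) := by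
    refine EntireFun.continuous_mk _ ?_
    unfold rescaledKac kacPoly
    fun_prop
  exact hc.measurable.comp_aemeasurable (aemeasurable_pi_lambda (fun ω k ↦ ξ k ω) hξ)

lemma measure_rescaledKacEntire_notMem_le [IsProbabilityMeasure P] (hindep : iIndepFun ξ P)
    (hident : ∀ k, IdentDistrib (ξ k) (ξ 0) P P) (hL : MemLp (ξ 0) 2 P)
    (hmean : ∫ ω, ξ 0 ω ∂P = 0) (hvar : ∫ ω, ‖ξ 0 ω‖ ^ 2 ∂P = 1) (θ : ℝ) (n : ℕ) {M : ℝ}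
    (hM : 0 < M) :
    P {ω | rescaledKacEntire ξ θ n ω ∉ EntireFun.coeffBounded M} ≤ ENNReal.ofReal (4 / M ^ 2) := by
  let r : ℕ → ℝ := fun j ↦ M * (2 ^ j / j.factorial)
  have hr (j : ℕ) : 0 < r j := by positivity
  have hsub : {ω | rescaledKacEntire ξ θ n ω ∉ EntireFun.coeffBounded M} ⊆
      ⋃ j, {ω | r j ^ 2 ≤ ‖kacCoeff ξ θ n j ω‖ ^ 2} := by
    intro ω hω
    by_contra h
    simp only [Set.mem_iUnion, Set.mem_ofPred_eq, not_exists, not_le] at h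
    exact hω ⟨fun j ↦ kacCoeff ξ θ n j ω,
      fun j ↦ (lt_of_pow_lt_pow_left₀ 2 (hr j).le (h j)).le, rescaledKac_eq_tsum ξ θ n ω⟩
  -- Chebyshev: the factor `2 ^ j` in the radius makes the bounds summable over `j`.
  have hbound (j : ℕ) : P {ω | r j ^ 2 ≤ ‖kacCoeff ξ θ n j ω‖ ^ 2} ≤
      ENNReal.ofReal (2 / M ^ 2 * (1 / 4) ^ j) := by
    have hLj : MemLp (kacCoeff ξ θ n j) 2 P :=
      memLp_finsetSum _ fun k _ ↦ ((hident k).memLp_iff.2 hL).const_mul _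
    have h := mul_meas_ge_le_integral_of_nonneg (μ := P)
      (f := fun ω ↦ ‖kacCoeff ξ θ n j ω‖ ^ 2) (Eventually.of_forall fun ω ↦ by positivity)
      (hLj.integrable_norm_pow (by norm_num)) (r j ^ 2)
    have h2 := h.trans (integral_norm_sq_kacCoeff_le hindep hident hL hmean hvar θ n j)
    rw [← le_div_iff₀' (by have := hr j; positivity)] at h2
    rw [← ofReal_measureReal]
    refine ENNReal.ofReal_le_ofReal (h2.trans (le_of_eq ?_))
    have h4 : (4 : ℝ) ^ j = (2 ^ j) ^ 2 := by rw [← pow_mul, mul_comm, pow_mul]; norm_num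
    simp only [r]
    rw [div_pow, one_pow, h4]
    field_simp
  have hgeom : Summable fun j : ℕ ↦ 2 / M ^ 2 * (1 / 4 : ℝ) ^ j :=
    (summable_geometric_of_lt_one (by norm_num) (by norm_num)).mul_left _
  calc _ ≤ ∑' j, P {ω | r j ^ 2 ≤ ‖kacCoeff ξ θ n j ω‖ ^ 2} :=
        (measure_mono hsub).trans (measure_iUnion_le _)
    _ ≤ ∑' j, ENNReal.ofReal (2 / M ^ 2 * (1 / 4) ^ j) := ENNReal.tsum_le_tsum hbound
    _ = ENNReal.ofReal (∑' j, 2 / M ^ 2 * (1 / 4) ^ j) :=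
        (ENNReal.ofReal_tsum_of_nonneg (fun j ↦ by positivity) hgeom).symm
    _ ≤ ENNReal.ofReal (4 / M ^ 2) := by
        refine ENNReal.ofReal_le_ofReal ?_
        rw [tsum_mul_left, tsum_geometric_of_lt_one (by norm_num) (by norm_num), div_mul_eq_mul_div]
        gcongr
        norm_num

lemma isTightMeasureSet_map_rescaledKacEntire [IsProbabilityMeasure P] (hindep : iIndepFun ξ P)
    (hident : ∀ k, IdentDistrib (ξ k) (ξ 0) P P) (hL : MemLp (ξ 0) 2 P)
    (hmean : ∫ ω, ξ 0 ω ∂P = 0) (hvar : ∫ ω, ‖ξ 0 ω‖ ^ 2 ∂P = 1) (θ : ℝ) :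
    IsTightMeasureSet (Set.range fun n ↦ P.map (rescaledKacEntire ξ θ n)) := by
  rw [isTightMeasureSet_iff_exists_isCompact_measure_compl_le]
  intro ε hε
  have hlim : Tendsto (fun M : ℝ ↦ ENNReal.ofReal (4 / M ^ 2)) atTop (𝓝 0) := by
    have h : Tendsto (fun M : ℝ ↦ 4 / M ^ 2) atTop (𝓝 0) :=
      tendsto_const_nhds.div_atTop (tendsto_pow_atTop two_ne_zero)
    simpa using ENNReal.tendsto_ofReal h
  obtain ⟨M, hM0, hM⟩ := ((eventually_gt_atTop 0).and (hlim.eventually (gt_mem_nhds hε))).exists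
  refine ⟨EntireFun.coeffBounded M, EntireFun.isCompact_coeffBounded M, ?_⟩
  rintro _ ⟨n, rfl⟩
  have hK := (EntireFun.isCompact_coeffBounded M).isClosed.measurableSet
  dsimp only
  rw [Measure.map_apply_of_aemeasurable
    (aemeasurable_rescaledKacEntire (fun k ↦ (hident k).aemeasurable_fst) θ n) hK.compl]
  exact (measure_rescaledKacEntire_notMem_le hindep hident hL hmean hvar θ n hM0).trans hM.le

end Tightness

/-! ### Convergence in distribution -/

/-- A non-integrable function has Bochner integral 0, so the value 1 certifies integrability. -/
lemma memLp_two_of_integral_norm_sq_eq_one {Ω : Type*} [MeasurableSpace Ω] {P : Measure Ω}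
    {X : Ω → ℂ} (hX : AEMeasurable X P) (h : ∫ ω, ‖X ω‖ ^ 2 ∂P = 1) : MemLp X 2 P := by
  rw [memLp_two_iff_integrable_sq_norm hX.aestronglyMeasurable]
  by_contra hi
  rw [integral_undef hi] at h
  exact zero_ne_one h

/-- Every limit point of tight laws on `EntireFun` with converging finite-dimensional
characteristic functions is the law of the limiting Gaussian analytic function. -/
lemma exists_tendsto_ultrafilter_hasGAFCharFun {μ : ℕ → ProbabilityMeasure EntireFun}
    (htight : IsTightMeasureSet (Set.range fun n ↦ (μ n : Measure EntireFun)))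
    (hchar : ∀ (I : Finset ℂ) (s : ℂ → ℂ), Tendsto
      (fun n ↦ ∫ f : EntireFun, Complex.exp ((evalSum I s f).re * Complex.I) ∂(μ n)) atTop
      (𝓝 (Real.exp (-(gafForm I s / 4)) : ℂ)))
    (U : Ultrafilter ℕ) (hU : (U : Filter ℕ) ≤ atTop) :
    ∃ ν : ProbabilityMeasure EntireFun, Tendsto μ U (𝓝 ν) ∧
      HasGAFCharFun (ν : Measure EntireFun) := by
  -- Prokhorov's theorem.
  have hcomp : IsCompact (closure (Set.range μ)) := by
    refine isCompact_closure_of_isTightMeasureSet (htight.subset ?_)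
    rintro _ ⟨_, ⟨n, rfl⟩, rfl⟩
    exact ⟨n, rfl⟩
  obtain ⟨ν, -, hν⟩ := hcomp.ultrafilter_le_nhds (U.map μ)
    (le_principal_iff.2 (mem_of_superset (range_mem_map (m := μ)) subset_closure))
  have hν' : Tendsto μ U (𝓝 ν) := hν
  refine ⟨ν, hν', fun I s ↦ ?_⟩
  have hc : Continuous (fun f : EntireFun ↦ Complex.exp ((evalSum I s f).re * Complex.I)) := by
    have := continuous_evalSum I s
    fun_prop
  let g : BoundedContinuousFunction EntireFun ℂ :=
    BoundedContinuousFunction.ofNormedAddCommGroup _ hc 1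
      fun f ↦ (Complex.norm_exp_ofReal_mul_I _).le
  exact tendsto_nhds_unique
    ((ProbabilityMeasure.tendsto_iff_forall_integral_rclike_tendsto ℂ).1 hν' g)
    ((hchar I s).mono_left hU)

end

theorem lemma3 {Ω : Type*} [MeasurableSpace Ω] (P : Measure Ω) [IsProbabilityMeasure P]
    (ξ : ℕ → Ω → ℂ) (h_indep : iIndepFun ξ P) (h_ident : ∀ k, IdentDistrib (ξ k) (ξ 0) P P)
    (h_mean : ∫ ω, ξ 0 ω ∂P = 0) (h_var : ∫ ω, ‖ξ 0 ω‖ ^ 2 ∂P = 1)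
    (θ : ℝ) (hθ : θ ∈ Set.Ioo 0 Real.pi) :
    (∃ ν : Measure EntireFun, IsLimitGAF (fun g : EntireFun ↦ g) ν) ∧
    ∀ {Ω' : Type*} [MeasurableSpace Ω'] (P' : Measure Ω') [IsProbabilityMeasure P']
      (G : Ω' → EntireFun), IsLimitGAF G P' →
      TendstoInDistribution (fun n : ℕ ↦ rescaledKacEntire ξ θ n) atTop G (fun _ ↦ P) P' := by
  have hL := memLp_two_of_integral_norm_sq_eq_one (h_ident 0).aemeasurable_fst h_var
  have hm := aemeasurable_rescaledKacEntire (fun k ↦ (h_ident k).aemeasurable_fst) θ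
  let μ : ℕ → ProbabilityMeasure EntireFun := fun n ↦
    ⟨P.map (rescaledKacEntire ξ θ n), Measure.isProbabilityMeasure_map (hm n)⟩
  have hlimit := exists_tendsto_ultrafilter_hasGAFCharFun (μ := μ)
    (isTightMeasureSet_map_rescaledKacEntire h_indep h_ident hL h_mean h_var θ) fun I s ↦ by
      refine (tendsto_integral_exp_evalSum_rescaledKac h_indep h_ident hL h_mean h_var hθ I s).congr
        fun n ↦ ?_
      have hc : Continuous (fun f : EntireFun ↦ Complex.exp ((evalSum I s f).re * Complex.I)) := by
        have := continuous_evalSum I s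
        fun_prop
      exact (integral_map (hm n) hc.aestronglyMeasurable).symm
  refine ⟨?_, fun {Ω'} _ P' _ G hG ↦ ⟨hm, hG.aemeasurable, ?_⟩⟩
  -- Any limit point of the laws of F_n serves as the law of G.
  · obtain ⟨ν, -, hν⟩ := hlimit (Ultrafilter.of atTop) (Ultrafilter.of_le _)
    exact ⟨ν, hν.isLimitGAF⟩
  · refine (tendsto_iff_ultrafilter _ _ _).2 fun U hU ↦ ?_
    obtain ⟨ν, hνlim, hν⟩ := hlimit U hU
    have := Measure.isProbabilityMeasure_map hG.aemeasurable
    have hνG : ν = ⟨P'.map G, Measure.isProbabilityMeasure_map hG.aemeasurable⟩ :=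
      Subtype.ext (hν.unique hG.hasGAFCharFun)
    exact hνG ▸ hνlim
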